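/- Let $(\mathcal S,\mathcal A,P,R,\gamma)$ be a Markov decision process with state space $\mathcal S\subseteq\mathbb R^{p}$, action space $\mathcal A\subseteq\mathbb R^{q}$, discount factor $\gamma\in(0,1)$ and a given initial state distribution; put $d=p+q$ and write $[s;a]\in\mathbb R^d$ for the concatenation of $s$ and $a$. For a (stochastic, Markovian) policy $\pi$ let $\rho^\pi=(1-\gamma)\sum_{t\ge 0}\gamma^t\,\Pr[(S_t,A_t)\in\cdot\mid\pi]$ be its occupancy measure, viewed as a probability measure on $\mathbb R^d$ through $(s,a)\mapsto[s;a]$. For $\sigma>0$ let $k(x,y)=\exp(-\|x-y\|^2/(2\sigma^2))$ be the Gaussian kernel on $\mathbb R^d$, with feature map $\Phi(x)=k(\cdot,x)$ into its reproducing kernel Hilbert space, and let $\mathrm{MMD}(P,Q)=\|\mathbb E_{X\sim P}\Phi(X)-\mathbb E_{Y\sim Q}\Phi(Y)\|$. Let $\phi(x)=\sqrt{2/D}\,\big(\cos(w_i^{T}x+b_i)\big)_{i=1}^{D}$ be random Fourier features, with independent $w_i\sim\mathcal N(0,\sigma^{-2}I)$ and $b_i\sim\mathcal U(0,2\pi)$.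 For a trajectory $\tau=(s_t,a_t)_{t\ge0}$ put $$z(\tau)=(1-\gamma)\sum_{t=0}^{\infty}\gamma^t\phi([s_t;a_t]),\qquad z^{T}(\tau)=(1-\gamma)\sum_{t=0}^{T-1}\gamma^t\phi([s_t;a_t]).$$ There are universal constants $c_1>0$ and $C>0$ such that the following holds for every such process, any two policies $\pi_1,\pi_2$ with occupancy measures $P,Q$, and all $\sigma>0$, $n\ge1$, $D\ge1$, $\varepsilon>0$. Draw $n$ independent trajectories of $\pi_1$ and $n$ independent trajectories of $\pi_2$, independently of each other and of the features $(w_i,b_i)_i$. Let $\psi_P,\psi_Q$ be the averages of $z$, and $\psi^T_P,\psi^T_Q$ the averages of $z^T$, over the $n$ trajectories of $\pi_1$, respectively $\pi_2$. Put $$B=2e^{-nc_1\varepsilon^2}+\frac{C}{\varepsilon^2}\exp\!\Big(\frac{-D\varepsilon^2}{64(d+2)}\Big)+6e^{-n\varepsilon^2/8}+8e^{-n\varepsilon^2/64}.$$ 1. (Infinite horizon.) $\Pr\big[\,\big|\|\psi_P-\psi_Q\|_2-\mathrm{MMD}(P,Q)\big|\ge\tfrac{11}{4}\varepsilon\,\big]\le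 B.$ 2. (Finite horizon.) For every $T\ge0$, $\Pr\big[\,\big|\|\psi^T_P-\psi^T_Q\|_2-\mathrm{MMD}(P,Q)\big|\ge\tfrac{11}{4}\varepsilon+2\sqrt2\,\gamma^T\,\big]\le B.$ Moreover, for every realization of the features, $\|\mathbb E_{\pi_1}[z]-\mathbb E_{\pi_1}[z^T]\|_2+\|\mathbb E_{\pi_2}[z]-\mathbb E_{\pi_2}[z^T]\|_2\le2\sqrt2\,\gamma^T$, where $\mathbb E_{\pi_i}$ is the expectation over a trajectory of $\pi_i$. -/

import Mathlib

open MeasureTheory ProbabilityTheory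
open scoped ENNReal

/-! ### The Gaussian kernel, its reproducing kernel Hilbert space, and the MMD -/

/-- The Gaussian kernel `k(x, y) = exp(-‖x - y‖² / (2σ²))` on `ℝᵈ`. -/
noncomputable def gaussianKernel {d : ℕ} (σ : ℝ) (x y : EuclideanSpace ℝ (Fin d)) : ℝ :=
  Real.exp (-‖x - y‖ ^ 2 / (2 * σ ^ 2))

/-- The Gaussian kernel in the operator-valued format of Mathlib's `RKHS`: the real number `k(x, y)`
is read as the operator of multiplication by `k(x, y)` on `ℝ`. -/
noncomputable def gaussianKernelOp (d : ℕ) (σ : ℝ) :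
    Matrix (EuclideanSpace ℝ (Fin d)) (EuclideanSpace ℝ (Fin d)) (ℝ →L[ℝ] ℝ) :=
  Matrix.of fun x y => gaussianKernel σ x y • ContinuousLinearMap.id ℝ ℝ

/-- The Gaussian kernel as the average of `cos ⟨u, σ⁻¹(x - y)⟩` over a standard Gaussian `u`. -/
theorem gaussianKernel_eq_integral {d : ℕ} (σ : ℝ) (x y : EuclideanSpace ℝ (Fin d)) :
    gaussianKernel σ x y
      = ∫ u, Real.cos (inner ℝ u (σ⁻¹ • (x - y))) ∂(stdGaussian (EuclideanSpace ℝ (Fin d))) := by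
  have h := charFun_stdGaussian (E := EuclideanSpace ℝ (Fin d)) (σ⁻¹ • (x - y))
  rw [charFun_apply] at h
  have hint : Integrable
      (fun u => Complex.exp (((inner ℝ u (σ⁻¹ • (x - y)) : ℝ) : ℂ) * Complex.I))
      (stdGaussian (EuclideanSpace ℝ (Fin d))) := by
    refine Integrable.of_bound (by fun_prop) 1 (.of_forall fun u => ?_)
    simp [Complex.norm_exp_ofReal_mul_I]
  have h2 := congrArg Complex.re h
  have h3 := integral_re hint
  simp only [RCLike.re_eq_complex_re] at h3
  rw [← h3] at h2
  simp only [Complex.exp_ofReal_mul_I_re] at h2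
  rw [h2, gaussianKernel]
  have h4 : (-((‖σ⁻¹ • (x - y)‖ : ℝ) : ℂ) ^ 2 / 2)
      = ((-‖σ⁻¹ • (x - y)‖ ^ 2 / 2 : ℝ) : ℂ) := by push_cast; ring
  rw [h4, Complex.exp_ofReal_re, norm_smul, mul_pow, norm_inv, inv_pow, Real.norm_eq_abs, sq_abs]
  congr 1
  by_cases hσ : σ = 0
  · simp [hσ]
  · field_simp

open scoped ComplexOrder in
theorem gaussianKernelOp_posSemidef (d : ℕ) (σ : ℝ) : (gaussianKernelOp d σ).PosSemidef := by
  have htfae := (RKHS.posSemidef_tfae (K := gaussianKernelOp d σ)).out 0 2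
  refine htfae.2 ⟨?_, fun v => ?_⟩
  · ext x y
    simp only [gaussianKernelOp, gaussianKernel, Matrix.conjTranspose_apply, Matrix.of_apply,
      norm_sub_rev x y, star_smul, star_trivial, ContinuousLinearMap.star_eq_adjoint]
    rw [show (ContinuousLinearMap.id ℝ ℝ).adjoint = ContinuousLinearMap.id ℝ ℝ from
      star_one (R := ℝ →L[ℝ] ℝ)]
  · simp only [RCLike.re_to_real, Finsupp.sum, gaussianKernelOp, Matrix.of_apply]
    set μ := stdGaussian (EuclideanSpace ℝ (Fin d)) with hμ
    have key : ∀ x y : EuclideanSpace ℝ (Fin d),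
        inner ℝ ((gaussianKernel σ y x • ContinuousLinearMap.id ℝ ℝ) (v x)) (v y)
        = ∫ u, ((v x * Real.cos (inner ℝ u (σ⁻¹ • x))) * (v y * Real.cos (inner ℝ u (σ⁻¹ • y)))
          + (v x * Real.sin (inner ℝ u (σ⁻¹ • x))) * (v y * Real.sin (inner ℝ u (σ⁻¹ • y)))) ∂μ := by
      intro x y
      have : ∀ u : EuclideanSpace ℝ (Fin d),
          (v x * Real.cos (inner ℝ u (σ⁻¹ • x))) * (v y * Real.cos (inner ℝ u (σ⁻¹ • y)))
          + (v x * Real.sin (inner ℝ u (σ⁻¹ • x))) * (v y * Real.sin (inner ℝ u (σ⁻¹ • y)))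
          = (v x * v y) * Real.cos (inner ℝ u (σ⁻¹ • (y - x))) := by
        intro u
        rw [smul_sub, inner_sub_right, Real.cos_sub]
        ring
      simp only [this, integral_const_mul, hμ, ← gaussianKernel_eq_integral]
      simp
      ring
    have hint : ∀ x y : EuclideanSpace ℝ (Fin d), Integrable (fun u =>
        (v x * Real.cos (inner ℝ u (σ⁻¹ • x))) * (v y * Real.cos (inner ℝ u (σ⁻¹ • y)))
          + (v x * Real.sin (inner ℝ u (σ⁻¹ • x))) * (v y * Real.sin (inner ℝ u (σ⁻¹ • y)))) μ := by
      intro x y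
      have : ∀ u : EuclideanSpace ℝ (Fin d),
          (v x * Real.cos (inner ℝ u (σ⁻¹ • x))) * (v y * Real.cos (inner ℝ u (σ⁻¹ • y)))
          + (v x * Real.sin (inner ℝ u (σ⁻¹ • x))) * (v y * Real.sin (inner ℝ u (σ⁻¹ • y)))
          = (v x * v y) * Real.cos (inner ℝ u (σ⁻¹ • (y - x))) := by
        intro u
        rw [smul_sub, inner_sub_right, Real.cos_sub]
        ring
      simp only [this]
      refine Integrable.const_mul ?_ _
      refine Integrable.of_bound (by fun_prop) 1 (.of_forall fun u => ?_)
      simpa using Real.abs_cos_le_one _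
    simp only [key]
    have swap : (∑ x ∈ v.support, ∑ y ∈ v.support, ∫ u,
        ((v x * Real.cos (inner ℝ u (σ⁻¹ • x))) * (v y * Real.cos (inner ℝ u (σ⁻¹ • y)))
          + (v x * Real.sin (inner ℝ u (σ⁻¹ • x))) * (v y * Real.sin (inner ℝ u (σ⁻¹ • y)))) ∂μ)
        = ∫ u, ((∑ x ∈ v.support, v x * Real.cos (inner ℝ u (σ⁻¹ • x))) ^ 2
          + (∑ x ∈ v.support, v x * Real.sin (inner ℝ u (σ⁻¹ • x))) ^ 2) ∂μ := by
      have h1 : ∀ x ∈ v.support, (∑ y ∈ v.support, ∫ u,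
          ((v x * Real.cos (inner ℝ u (σ⁻¹ • x))) * (v y * Real.cos (inner ℝ u (σ⁻¹ • y)))
          + (v x * Real.sin (inner ℝ u (σ⁻¹ • x))) * (v y * Real.sin (inner ℝ u (σ⁻¹ • y)))) ∂μ)
          = ∫ u, ∑ y ∈ v.support,
          ((v x * Real.cos (inner ℝ u (σ⁻¹ • x))) * (v y * Real.cos (inner ℝ u (σ⁻¹ • y)))
          + (v x * Real.sin (inner ℝ u (σ⁻¹ • x))) * (v y * Real.sin (inner ℝ u (σ⁻¹ • y)))) ∂μ :=
        fun x _ => (integral_finsetSum _ fun y _ => hint x y).symm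
      rw [Finset.sum_congr rfl h1,
        ← integral_finsetSum _ fun x _ => integrable_finsetSum _ fun y _ => hint x y]
      refine integral_congr_ae (.of_forall fun u => ?_)
      simp only [sq, Finset.sum_mul_sum, ← Finset.sum_add_distrib]
    rw [swap]
    exact integral_nonneg fun u => by positivity

open scoped ComplexOrder in
instance gaussianKernelOp_fact (d : ℕ) (σ : ℝ) : Fact (gaussianKernelOp d σ).PosSemidef :=
  ⟨gaussianKernelOp_posSemidef d σ⟩

/-- The reproducing kernel Hilbert space of the Gaussian kernel of width `σ` on `ℝᵈ`. -/
abbrev GaussianRKHS (d : ℕ) (σ : ℝ) : Type := RKHS.OfKernel (gaussianKernelOp d σ)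

/-- The canonical feature map `x ↦ k(·, x)` of the Gaussian kernel. -/
noncomputable def gaussianFeature {d : ℕ} (σ : ℝ) (x : EuclideanSpace ℝ (Fin d)) :
    GaussianRKHS d σ :=
  RKHS.kerFun (GaussianRKHS d σ) x (1 : ℝ)

theorem inner_gaussianFeature {d : ℕ} (σ : ℝ) (x y : EuclideanSpace ℝ (Fin d)) :
    inner ℝ (gaussianFeature σ x) (gaussianFeature σ y) = gaussianKernel σ x y := by
  have h := RKHS.kernel_inner (GaussianRKHS d σ) y x (1 : ℝ) (1 : ℝ)
  rw [RKHS.OfKernel.kernel_ofKernel] at h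
  rw [gaussianFeature, gaussianFeature, ← h]
  simp [gaussianKernelOp, gaussianKernel, norm_sub_rev x y]

/-- The maximum mean discrepancy `‖E_{X∼P} Φ(X) - E_{Y∼Q} Φ(Y)‖`, where `Φ` is the feature map of
the Gaussian kernel of width `σ`. -/
noncomputable def gaussianMMD {d : ℕ} (σ : ℝ) (P Q : Measure (EuclideanSpace ℝ (Fin d))) : ℝ :=
  ‖(∫ x, gaussianFeature σ x ∂P) - ∫ y, gaussianFeature σ y ∂Q‖

/-! ### Markov decision processes, trajectories and occupancy measures -/

/-- A discounted Markov decision process with state space `S` and action space `A`, together with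
the distribution of the initial state. -/
structure MDP (S A : Type*) [MeasurableSpace S] [MeasurableSpace A] where
  /-- transition probabilities `P(s' | s, a)` -/
  transition : Kernel (S × A) S
  /-- reward function -/
  reward : S × A → ℝ
  /-- discount factor -/
  discount : ℝ
  /-- distribution of the initial state -/
  init : Measure S
  markov_transition : IsMarkovKernel transition
  prob_init : IsProbabilityMeasure init
  discount_pos : 0 < discount
  discount_lt_one : discount < 1

namespace MDP

attribute [instance] MDP.markov_transition MDP.prob_init

variable {S A : Type*} [MeasurableSpace S] [MeasurableSpace A]

/-- One step of the state-action process under the policy `π`, given the history up to time `t`: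
the next state is drawn from the transition probabilities at the current state-action pair and the
next action from `π` at the next state. -/
noncomputable def step (M : MDP S A) (π : Kernel S A) (t : ℕ) :
    Kernel (Finset.Iic t → S × A) (S × A) :=
  (M.transition.compProd (Kernel.prodMkLeft (S × A) π)).comap
    (fun h => h ⟨t, Finset.mem_Iic.2 le_rfl⟩) (measurable_pi_apply _)

instance isMarkovKernel_step (M : MDP S A) (π : Kernel S A) [IsMarkovKernel π] (t : ℕ) :
    IsMarkovKernel (M.step π t) := by
  unfold step
  infer_instance

/-- The law of the infinite trajectory `(S₀, A₀), (S₁, A₁), …` under the policy `π`. -/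
noncomputable def trajectoryLaw (M : MDP S A) (π : Kernel S A) [IsMarkovKernel π] :
    Measure (ℕ → S × A) :=
  Kernel.trajMeasure (X := fun _ => S × A) (M.init.compProd π) (M.step π)

instance isProbabilityMeasure_trajectoryLaw (M : MDP S A) (π : Kernel S A) [IsMarkovKernel π] :
    IsProbabilityMeasure (M.trajectoryLaw π) := by
  unfold trajectoryLaw
  infer_instance

/-- The occupancy measure `ρ^π = (1 - γ) ∑ₜ γᵗ P((Sₜ, Aₜ) ∈ · | π)`. -/
noncomputable def occupancy (M : MDP S A) (π : Kernel S A) [IsMarkovKernel π] : Measure (S × A) :=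
  Measure.sum fun t : ℕ => ENNReal.ofReal ((1 - M.discount) * M.discount ^ t) •
    (M.trajectoryLaw π).map (fun τ => τ t)

end MDP

/-! ### Random Fourier features and trajectory embeddings -/

/-- The concatenation `[s; a]` of a state vector and an action vector. -/
noncomputable def concat {p q : ℕ} {S : Set (EuclideanSpace ℝ (Fin p))}
    {A : Set (EuclideanSpace ℝ (Fin q))} (x : S × A) : EuclideanSpace ℝ (Fin (p + q)) :=
  WithLp.toLp 2 (Fin.append (x.1 : EuclideanSpace ℝ (Fin p)) (x.2 : EuclideanSpace ℝ (Fin q)))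

theorem measurable_concat {p q : ℕ} {S : Set (EuclideanSpace ℝ (Fin p))}
    {A : Set (EuclideanSpace ℝ (Fin q))} :
    Measurable (concat : S × A → EuclideanSpace ℝ (Fin (p + q))) := by
  refine (WithLp.measurable_toLp 2 _).comp (measurable_pi_iff.2 fun i => ?_)
  refine Fin.addCases (fun i => ?_) (fun i => ?_) i
  · simp only [Fin.append_left]
    fun_prop
  · simp only [Fin.append_right]
    fun_prop

/-- The feature map `φ(x) = √(2/D) (cos(⟨wᵢ, x⟩ + bᵢ))_{i < D}` with parameters
`θ i = (wᵢ, bᵢ)`. -/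
noncomputable def fourierFeature {d D : ℕ} (θ : Fin D → EuclideanSpace ℝ (Fin d) × ℝ)
    (x : EuclideanSpace ℝ (Fin d)) : EuclideanSpace ℝ (Fin D) :=
  WithLp.toLp 2 fun i => Real.sqrt (2 / D) * Real.cos (inner ℝ (θ i).1 x + (θ i).2)

/-- The law of one feature parameter `(w, b)`: independent `w ∼ N(0, σ⁻² I)` and
`b ∼ U(0, 2π)`. -/
noncomputable def featureLaw (d : ℕ) (σ : ℝ) : Measure (EuclideanSpace ℝ (Fin d) × ℝ) :=
  (multivariateGaussian 0 ((σ ^ 2)⁻¹ • (1 : Matrix (Fin d) (Fin d) ℝ))).prod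
    (cond volume (Set.Icc 0 (2 * Real.pi)))

section Embedding

variable {p q D : ℕ} {S : Set (EuclideanSpace ℝ (Fin p))} {A : Set (EuclideanSpace ℝ (Fin q))}

/-- The trajectory feature `z = (1 - γ) ∑_{t ≥ 0} γᵗ φ(sₜ, aₜ)`. -/
noncomputable def trajFeature (γ : ℝ) (θ : Fin D → EuclideanSpace ℝ (Fin (p + q)) × ℝ)
    (τ : ℕ → S × A) : EuclideanSpace ℝ (Fin D) :=
  (1 - γ) • ∑' t : ℕ, γ ^ t • fourierFeature θ (concat (τ t))

/-- The feature `z^T = (1 - γ) ∑_{t=0}^{T-1} γᵗ φ(sₜ, aₜ)` of a trajectory truncated to its first `T`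
steps. -/
noncomputable def truncTrajFeature (γ : ℝ) (T : ℕ)
    (θ : Fin D → EuclideanSpace ℝ (Fin (p + q)) × ℝ) (τ : ℕ → S × A) :
    EuclideanSpace ℝ (Fin D) :=
  (1 - γ) • ∑ t ∈ Finset.range T, γ ^ t • fourierFeature θ (concat (τ t))

/-- The policy embedding `ψ`: the mean of the trajectory features of `n` trajectories. -/
noncomputable def embedding {n : ℕ} (γ : ℝ) (θ : Fin D → EuclideanSpace ℝ (Fin (p + q)) × ℝ)
    (τ : Fin n → ℕ → S × A) : EuclideanSpace ℝ (Fin D) :=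
  (n : ℝ)⁻¹ • ∑ j, trajFeature γ θ (τ j)

/-- The policy embedding `ψ^T` computed from `n` trajectories truncated to `T` steps. -/
noncomputable def truncEmbedding {n : ℕ} (γ : ℝ) (T : ℕ)
    (θ : Fin D → EuclideanSpace ℝ (Fin (p + q)) × ℝ) (τ : Fin n → ℕ → S × A) :
    EuclideanSpace ℝ (Fin D) :=
  (n : ℝ)⁻¹ • ∑ j, truncTrajFeature γ T θ (τ j)

end Embedding

/-- The right-hand side of the tail bound, with `c₁` and `C` the two unspecified constants:
`2 e^{-n c₁ ε²} + C ε⁻² e^{-Dε²/(64(d+2))} + 6 e^{-nε²/8} + 8 e^{-nε²/64}`. -/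
noncomputable def tailBound (c₁ C : ℝ) (n D d : ℕ) (ε : ℝ) : ℝ :=
  2 * Real.exp (-(n * c₁ * ε ^ 2))
    + C * (1 / ε ^ 2 * Real.exp (-(D * ε ^ 2) / (64 * (d + 2))))
    + 6 * Real.exp (-(n * ε ^ 2) / 8)
    + 8 * Real.exp (-(n * ε ^ 2) / 64)

/-! ### Concentration inequalities -/

/-! Fix the features and let `m₁`, `m₂` be the expected trajectory features of the two policies. The
error splits into a sampling part, the distance from `‖ψ_P - ψ_Q‖` to `‖m₁ - m₂‖`, and a feature
part, the distance from `‖m₁ - m₂‖` to the MMD.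

Feature part. Discounted trajectory averages integrate to occupancy averages
(`integral_discounted_sum`), so `‖m₁ - m₂‖² = 8 · (∑ Y(θᵢ)) / D` with `Y = (meanCos P - meanCos Q)²
/ 4`, a variable in `[0, 1]`. Expanding the Gaussian kernel in random features gives `MMD² = 8 · E
Y` (`gaussianMMD_sq`). A Chernoff bound for the square root of a mean
(`measure_abs_sqrt_mean_sub_sqrt_ge_le`) then controls the difference by `2 exp(-Dε²/128)`. Only one
scalar function of the feature is involved, so no covering of `ℝᵈ` is needed and the factors `1/ε²`
and `d + 2` of the bound are slack.

Sampling part. Trajectory features have norm at most `√2`, so McDiarmid's inequality and a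
second-moment bound give a dimension-free tail for each policy (`measure_norm_mean_sub_ge_le`),
uniformly in the features; Fubini removes the conditioning.

The stated bound is at least `1` when `nε² ≤ 128`, and the event is empty when `ε > 2`, so the
probabilistic estimate is needed only outside these ranges. Truncation is deterministic: it moves
each embedding by at most `√2 γ^T`. -/

theorem integrable_of_abs_le {X : Type*} [MeasurableSpace X] {ν : Measure X} [IsFiniteMeasure ν]
    {f : X → ℝ} (hf : Measurable f) {K : ℝ} (hK : ∀ x, |f x| ≤ K) : Integrable f ν :=
  Integrable.of_bound hf.aestronglyMeasurable K (.of_forall hK)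

theorem integrable_exp_mul_of_abs_le {X : Type*} [MeasurableSpace X] {ν : Measure X}
    [IsFiniteMeasure ν] {f : X → ℝ} (hf : Measurable f) {K : ℝ} (hK : ∀ x, |f x| ≤ K) (l : ℝ) :
    Integrable (fun x => Real.exp (l * f x)) ν := by
  refine integrable_of_abs_le (by fun_prop) (K := Real.exp (|l| * K)) fun x => ?_
  rw [Real.abs_exp, Real.exp_le_exp]
  calc l * f x ≤ |l * f x| := le_abs_self _
    _ = |l| * |f x| := abs_mul _ _
    _ ≤ |l| * K := by gcongr; exact hK x

/-- Hoeffding's lemma for a function of oscillation at most `c`. -/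
theorem integral_exp_mul_le_of_oscillation {X : Type*} [MeasurableSpace X] (ν : Measure X)
    [IsProbabilityMeasure ν] {f : X → ℝ} (hf : Measurable f) {c : ℝ}
    (hosc : ∀ x y, |f x - f y| ≤ c) (l : ℝ) :
    ∫ x, Real.exp (l * f x) ∂ν ≤ Real.exp (l * ∫ x, f x ∂ν + (l * c) ^ 2 / 8) := by
  have : Nonempty X := ν.nonempty_of_neZero
  have x₀ : X := Classical.arbitrary X
  have hbdd : BddBelow (Set.range f) := by
    refine ⟨f x₀ - c, ?_⟩
    rintro _ ⟨x, rfl⟩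
    linarith [(abs_le.1 (hosc x x₀)).1]
  -- An oscillation bound places `f` in an interval of length `c` starting at its infimum, the
  -- setting of Hoeffding's lemma.
  have hmem : ∀ x, f x ∈ Set.Icc (⨅ x, f x) ((⨅ x, f x) + c) := by
    refine fun x => ⟨ciInf_le hbdd x, ?_⟩
    have : f x - c ≤ ⨅ x, f x := le_ciInf fun y => by linarith [(abs_le.1 (hosc x y)).2]
    linarith
  have h := (hasSubgaussianMGF_of_mem_Icc (μ := ν) hf.aemeasurable (.of_forall hmem)).mgf_le l
  have hc : (((‖(⨅ x, f x) + c - ⨅ x, f x‖₊ / 2) ^ 2 : NNReal) : ℝ) = c ^ 2 / 4 := by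
    push_cast
    rw [add_sub_cancel_left, Real.norm_eq_abs, div_pow, sq_abs]
    norm_num
  rw [hc, mgf] at h
  simp only [mul_sub, Real.exp_sub, div_eq_mul_inv] at h
  rw [integral_mul_const, ← div_eq_mul_inv, div_le_iff₀ (Real.exp_pos _), ← Real.exp_add] at h
  refine h.trans (le_of_eq ?_)
  congr 1
  ring

/-- McDiarmid's inequality, in its exponential moment form, for identically distributed
coordinates. -/
theorem integral_exp_mul_le_of_bounded_differences {E : Type*} [MeasurableSpace E] (ν : Measure E)
    [IsProbabilityMeasure ν] {c : ℝ} (l : ℝ) :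
    ∀ (n : ℕ) (f : (Fin n → E) → ℝ), Measurable f → (∃ K, ∀ x, |f x| ≤ K) →
      (∀ x i y, |f (Function.update x i y) - f x| ≤ c) →
      ∫ x, Real.exp (l * f x) ∂(Measure.pi fun _ => ν)
        ≤ Real.exp (l * ∫ x, f x ∂(Measure.pi fun _ => ν) + n * (l * c) ^ 2 / 8) := by
  intro n
  induction n with
  | zero =>
    intro f hf _ _
    rw [Measure.pi_of_empty, integral_dirac, integral_dirac]
    simp
  | succ n ih =>
    rintro f hf ⟨K, hK⟩ hdiff
    have hmp := (measurePreserving_piFinSuccAbove (fun _ : Fin (n + 1) => ν) 0).symm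
    set e := MeasurableEquiv.piFinSuccAbove (fun _ : Fin (n + 1) => E) 0 with he
    have hcons : ∀ z : E × (Fin n → E), e.symm z = Fin.cons z.1 z.2 := fun z => by
      rw [he]
      simp [MeasurableEquiv.piFinSuccAbove, Fin.insertNthEquiv]
    have hF : Measurable fun z => f (e.symm z) := hf.comp e.symm.measurable
    have hsec : ∀ x, Measurable fun xs => f (e.symm (x, xs)) := fun x =>
      hF.comp measurable_prodMk_left
    have hFint : Integrable (fun z => f (e.symm z)) (ν.prod (Measure.pi fun _ : Fin n => ν)) :=
      integrable_of_abs_le hF fun z => hK _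
    have hEint : Integrable (fun z => Real.exp (l * f (e.symm z)))
        (ν.prod (Measure.pi fun _ : Fin n => ν)) :=
      integrable_exp_mul_of_abs_le hF (fun z => hK _) l
    -- Averaging out all coordinates but the first leaves a function of oscillation at most `c`.
    -- Hoeffding's lemma treats `g`, the induction hypothesis treats each section, and the exponents
    -- add.
    set g : E → ℝ := fun x => ∫ xs, f (e.symm (x, xs)) ∂(Measure.pi fun _ : Fin n => ν) with hg
    have hgm : Measurable g := by
      have : StronglyMeasurable (Function.uncurry fun x xs => f (e.symm (x, xs))) :=
        hF.stronglyMeasurable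
      exact this.integral_prod_right.measurable
    have hgK : ∀ x, |g x| ≤ K := fun x => by
      have := norm_integral_le_of_norm_le_const (μ := Measure.pi fun _ : Fin n => ν)
        (f := fun xs => f (e.symm (x, xs))) (C := K) (.of_forall fun xs => hK _)
      simpa using this
    have hgosc : ∀ x y, |g x - g y| ≤ c := fun x y => by
      simp only [hg]
      rw [← integral_sub (integrable_of_abs_le (hsec x) fun z => hK _)
        (integrable_of_abs_le (hsec y) fun z => hK _)]
      have := norm_integral_le_of_norm_le_const (μ := Measure.pi fun _ : Fin n => ν)
        (f := fun xs => f (e.symm (x, xs)) - f (e.symm (y, xs))) (C := c)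
        (.of_forall fun xs => by
          have h := hdiff (e.symm (y, xs)) 0 x
          rwa [hcons, Fin.update_cons_zero, ← hcons (x, xs), ← hcons (y, xs)] at h)
      simpa using this
    have h1 : ∫ x, Real.exp (l * f x) ∂(Measure.pi fun _ => ν)
        = ∫ x, ∫ xs, Real.exp (l * f (e.symm (x, xs))) ∂(Measure.pi fun _ : Fin n => ν) ∂ν := by
      rw [← hmp.integral_comp', integral_prod _ hEint]
    have h2 : ∫ x, f x ∂(Measure.pi fun _ => ν) = ∫ x, g x ∂ν := by
      rw [← hmp.integral_comp', integral_prod _ hFint]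
    rw [h1, h2]
    have hstep : ∀ x, ∫ xs, Real.exp (l * f (e.symm (x, xs))) ∂(Measure.pi fun _ : Fin n => ν)
        ≤ Real.exp (l * g x) * Real.exp (n * (l * c) ^ 2 / 8) := fun x => by
      rw [← Real.exp_add]
      refine ih _ (hsec x) ⟨K, fun xs => hK _⟩ fun xs i y => ?_
      have h := hdiff (e.symm (x, xs)) i.succ y
      rwa [hcons, ← Fin.cons_update, ← hcons (x, Function.update xs i y), ← hcons (x, xs)] at h
    calc ∫ x, ∫ xs, Real.exp (l * f (e.symm (x, xs))) ∂(Measure.pi fun _ : Fin n => ν) ∂ν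
        ≤ ∫ x, Real.exp (l * g x) * Real.exp (n * (l * c) ^ 2 / 8) ∂ν :=
          integral_mono hEint.integral_prod_left
            ((integrable_exp_mul_of_abs_le hgm hgK l).mul_const _) hstep
      _ = (∫ x, Real.exp (l * g x) ∂ν) * Real.exp (n * (l * c) ^ 2 / 8) := integral_mul_const _ _
      _ ≤ Real.exp (l * ∫ x, g x ∂ν + (l * c) ^ 2 / 8) * Real.exp (n * (l * c) ^ 2 / 8) := by
          gcongr
          exact integral_exp_mul_le_of_oscillation ν hgm hgosc l
      _ = _ := by
          rw [← Real.exp_add]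
          congr 1
          push_cast
          ring

/-- McDiarmid's inequality for identically distributed coordinates. -/
theorem measure_ge_le_of_bounded_differences {E : Type*} [MeasurableSpace E] (ν : Measure E)
    [IsProbabilityMeasure ν] {c : ℝ} (hc : 0 < c) {n : ℕ} (hn : 1 ≤ n) {f : (Fin n → E) → ℝ}
    (hf : Measurable f) (hbdd : ∃ K, ∀ x, |f x| ≤ K)
    (hdiff : ∀ x i y, |f (Function.update x i y) - f x| ≤ c) {s : ℝ} (hs : 0 ≤ s) :
    (Measure.pi fun _ => ν).real {x | (∫ x, f x ∂(Measure.pi fun _ => ν)) + s ≤ f x}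
      ≤ Real.exp (-(2 * s ^ 2 / (n * c ^ 2))) := by
  obtain ⟨K, hK⟩ := hbdd
  have hn' : (0 : ℝ) < n := by exact_mod_cast hn
  -- The minimizer of `-l s + n (l c)² / 8`.
  set l : ℝ := 4 * s / (n * c ^ 2) with hl
  have hl0 : 0 ≤ l := by positivity
  refine (measure_ge_le_exp_mul_mgf _ hl0 (integrable_exp_mul_of_abs_le hf hK l)).trans ?_
  refine (mul_le_mul_of_nonneg_left
    (integral_exp_mul_le_of_bounded_differences ν l n f hf ⟨K, hK⟩ hdiff)
    (Real.exp_pos _).le).trans (le_of_eq ?_)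
  rw [← Real.exp_add]
  congr 1
  rw [hl]
  field_simp
  ring

/-! ### Chernoff bounds for means of `[0, 1]`-valued variables -/

/-- The exponential moments of a `[0, 1]`-valued variable are at most those of a Poisson variable
with the same mean. -/
theorem integral_exp_mul_le_of_mem_Icc {X : Type*} [MeasurableSpace X] (ν : Measure X)
    [IsProbabilityMeasure ν] {Y : X → ℝ} (hY : Measurable Y) (h01 : ∀ x, Y x ∈ Set.Icc (0 : ℝ) 1)
    (l : ℝ) :
    ∫ x, Real.exp (l * Y x) ∂ν ≤ Real.exp ((∫ x, Y x ∂ν) * (Real.exp l - 1)) := by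
  have hb : ∀ x, |Y x| ≤ 1 := fun x => abs_le.2 ⟨by linarith [(h01 x).1], (h01 x).2⟩
  have hYi : Integrable Y ν := integrable_of_abs_le hY hb
  -- By convexity, `exp` lies below its chord over the segment from `0` to `l`.
  have hpt : ∀ x, Real.exp (l * Y x) ≤ 1 + Y x * (Real.exp l - 1) := fun x => by
    have := convexOn_exp.2 (Set.mem_univ 0) (Set.mem_univ l)
      (sub_nonneg.2 (h01 x).2) (h01 x).1 (by ring)
    simp only [smul_eq_mul, mul_zero, zero_add, Real.exp_zero, mul_one] at this
    rw [mul_comm]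
    linarith
  calc ∫ x, Real.exp (l * Y x) ∂ν ≤ ∫ x, (1 + Y x * (Real.exp l - 1)) ∂ν :=
        integral_mono (integrable_exp_mul_of_abs_le hY hb l)
          ((integrable_const _).add (hYi.mul_const _)) hpt
    _ = (∫ x, Y x ∂ν) * (Real.exp l - 1) + 1 := by
        rw [integral_add (integrable_const _) (hYi.mul_const _), integral_mul_const]
        simp [add_comm]
    _ ≤ _ := Real.add_one_le_exp _

theorem integral_exp_mul_sum_le_of_mem_Icc {X : Type*} [MeasurableSpace X] (ν : Measure X)
    [IsProbabilityMeasure ν] {Y : X → ℝ} (hY : Measurable Y) (h01 : ∀ x, Y x ∈ Set.Icc (0 : ℝ) 1)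
    (D : ℕ) (l : ℝ) :
    ∫ x, Real.exp (l * ∑ i, Y (x i)) ∂(Measure.pi fun _ : Fin D => ν)
      ≤ Real.exp (D * ((∫ x, Y x ∂ν) * (Real.exp l - 1))) := by
  simp only [Finset.mul_sum, Real.exp_sum]
  rw [integral_fintype_prod_eq_pow (fun x => Real.exp (l * Y x)), Fintype.card_fin,
    Real.exp_nat_mul]
  exact pow_le_pow_left₀ (integral_nonneg fun x => (Real.exp_pos (l * Y x)).le)
    (integral_exp_mul_le_of_mem_Icc ν hY h01 l) D

theorem exp_sub_one_le_add_sq {x : ℝ} (hx : |x| ≤ 1) : Real.exp x - 1 ≤ x + x ^ 2 := by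
  linarith [(abs_le.1 (Real.abs_exp_sub_one_sub_id_le hx)).2]

/-- A multiplicative Chernoff bound on the scale of square roots. -/
theorem measure_abs_sqrt_mean_sub_sqrt_ge_le {X : Type*} [MeasurableSpace X] (ν : Measure X)
    [IsProbabilityMeasure ν] {Y : X → ℝ} (hY : Measurable Y) (h01 : ∀ x, Y x ∈ Set.Icc (0 : ℝ) 1)
    {D : ℕ} (hD : 1 ≤ D) {s : ℝ} (hs : 0 < s) :
    (Measure.pi fun _ : Fin D => ν).real
        {x | s ≤ |Real.sqrt ((∑ i, Y (x i)) / D) - Real.sqrt (∫ x, Y x ∂ν)|}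
      ≤ 2 * Real.exp (-(D * s ^ 2 / 4)) := by
  have hD' : (0 : ℝ) < D := by exact_mod_cast hD
  set r := Real.sqrt (∫ x, Y x ∂ν)
  have hr0 : 0 ≤ r := Real.sqrt_nonneg _
  have hp : ∫ x, Y x ∂ν = r ^ 2 := (Real.sq_sqrt (integral_nonneg fun x => (h01 x).1)).symm
  have hsum0 : ∀ x : Fin D → X, 0 ≤ ∑ i, Y (x i) := fun x =>
    Finset.sum_nonneg fun i _ => (h01 _).1
  have hbd : ∀ x : Fin D → X, |∑ i, Y (x i)| ≤ D := fun x => by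
    rw [abs_of_nonneg (hsum0 x)]
    simpa using Finset.sum_le_card_nsmul Finset.univ (fun i => Y (x i)) 1 fun i _ => (h01 _).2
  have hmeas : Measurable fun x : Fin D → X => ∑ i, Y (x i) := by fun_prop
  have hexp : ∀ l, Integrable (fun x : Fin D → X => Real.exp (l * ∑ i, Y (x i)))
      (Measure.pi fun _ => ν) := integrable_exp_mul_of_abs_le hmeas hbd
  -- The variance proxy is proportional to the mean `r²`. The square root cancels this factor, which
  -- makes the tail independent of `r`.
  have hmgf : ∀ l, |l| ≤ 1 → mgf (fun x : Fin D → X => ∑ i, Y (x i)) (Measure.pi fun _ => ν) l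
      ≤ Real.exp (D * (r ^ 2 * (l + l ^ 2))) := fun l hl => by
    refine (integral_exp_mul_sum_le_of_mem_Icc ν hY h01 D l).trans ?_
    rw [Real.exp_le_exp, hp]
    gcongr
    exact exp_sub_one_le_add_sq hl
  have hup : (Measure.pi fun _ : Fin D => ν).real {x | D * (r + s) ^ 2 ≤ ∑ i, Y (x i)}
      ≤ Real.exp (-(D * s ^ 2 / 4)) := by
    -- The parameter `s / (r + s)` stays below `1` for every `r`, as `hmgf` requires, and already
    -- gives the exponent `-D s²`.
    have hl0 : 0 ≤ s / (r + s) := by positivity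
    have hl1 : s / (r + s) ≤ 1 := by rw [div_le_one (by positivity)]; linarith
    refine (measure_ge_le_exp_mul_mgf _ hl0 (hexp _)).trans ?_
    refine (mul_le_mul_of_nonneg_left (hmgf _ (by rwa [abs_of_nonneg hl0]))
      (Real.exp_pos _).le).trans ?_
    rw [← Real.exp_add, Real.exp_le_exp]
    have hrs : 0 < r + s := by positivity
    have key : -(s / (r + s)) * (D * (r + s) ^ 2)
        + D * (r ^ 2 * (s / (r + s) + (s / (r + s)) ^ 2))
        = -(D * s ^ 2) - D * s ^ 2 * (r * s) / (r + s) ^ 2 := by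
      field_simp
      ring
    rw [key]
    have h1 : 0 ≤ D * s ^ 2 * (r * s) / (r + s) ^ 2 := by positivity
    have h2 : 0 ≤ D * s ^ 2 := by positivity
    linarith
  have hlow : (Measure.pi fun _ : Fin D => ν).real
      {x | s ≤ r ∧ ∑ i, Y (x i) ≤ D * (r - s) ^ 2} ≤ Real.exp (-(D * s ^ 2 / 4)) := by
    -- A square root cannot fall more than `r` below `r`, so only `s ≤ r` matters. The parameter `-s
    -- / (2r)` yields the exponent `-D s² / 4`; this tail fixes the constant.
    by_cases hsr : s ≤ r
    · have hr1 : 0 < r := hs.trans_le hsr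
      have hl0 : -(s / (2 * r)) ≤ 0 := by rw [neg_nonpos]; positivity
      have hl1 : s / (2 * r) ≤ 1 := by rw [div_le_one (by positivity)]; linarith
      simp only [hsr, true_and]
      refine (measure_le_le_exp_mul_mgf _ hl0 (hexp _)).trans ?_
      refine (mul_le_mul_of_nonneg_left (hmgf _ (by rwa [abs_of_nonpos hl0, neg_neg]))
        (Real.exp_pos _).le).trans ?_
      rw [← Real.exp_add, Real.exp_le_exp]
      have key : -(-(s / (2 * r))) * (D * (r - s) ^ 2)
          + D * (r ^ 2 * (-(s / (2 * r)) + (-(s / (2 * r))) ^ 2))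
          = -(D * s ^ 2 / 4) - D * s ^ 2 * (r - s) / (2 * r) := by
        field_simp
        ring
      rw [key]
      have h1 : 0 ≤ D * s ^ 2 * (r - s) / (2 * r) :=
        div_nonneg (mul_nonneg (by positivity) (sub_nonneg.2 hsr)) (by positivity)
      linarith
    · simpa [hsr] using (Real.exp_pos _).le
  have hsub : {x : Fin D → X | s ≤ |Real.sqrt ((∑ i, Y (x i)) / D) - r|}
      ⊆ {x | D * (r + s) ^ 2 ≤ ∑ i, Y (x i)} ∪ {x | s ≤ r ∧ ∑ i, Y (x i) ≤ D * (r - s) ^ 2} := by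
    intro x hx
    have hsq := Real.sq_sqrt (div_nonneg (hsum0 x) hD'.le)
    have h0 := Real.sqrt_nonneg ((∑ i, Y (x i)) / D)
    set w := Real.sqrt ((∑ i, Y (x i)) / D)
    have hS : ∑ i, Y (x i) = D * w ^ 2 := by rw [hsq]; field_simp
    rcases le_abs.1 (show s ≤ |w - r| from hx) with h | h
    · left
      change (D : ℝ) * (r + s) ^ 2 ≤ ∑ i, Y (x i)
      rw [hS]
      gcongr
      linarith
    · right
      refine ⟨by linarith, ?_⟩
      rw [hS]
      gcongr
      linarith
  calc _ ≤ _ := measureReal_mono hsub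
    _ ≤ _ := measureReal_union_le _ _
    _ ≤ _ := add_le_add hup hlow
    _ = _ := by ring

theorem integral_euclideanSpace_apply {X : Type*} [MeasurableSpace X] {ν : Measure X} {D : ℕ}
    {z : X → EuclideanSpace ℝ (Fin D)} (hz : Integrable z ν) (i : Fin D) :
    (∫ x, z x ∂ν) i = ∫ x, z x i ∂ν :=
  ((EuclideanSpace.proj (𝕜 := ℝ) i).integral_comp_comm hz).symm

theorem sq_integral_le_integral_sq {X : Type*} [MeasurableSpace X] (ν : Measure X)
    [IsProbabilityMeasure ν] {f : X → ℝ} (hf : Measurable f) {K : ℝ} (hK : ∀ x, |f x| ≤ K) :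
    (∫ x, f x ∂ν) ^ 2 ≤ ∫ x, f x ^ 2 ∂ν := by
  have h := variance_nonneg f ν
  rw [variance_eq_sub (MemLp.of_bound hf.aestronglyMeasurable K (.of_forall hK))] at h
  simpa using h

/-! ### Means of independent bounded random vectors -/

section VectorMean

variable {E : Type*} [MeasurableSpace E] (ν : Measure E) [IsProbabilityMeasure ν] {D n : ℕ}
  {z : E → EuclideanSpace ℝ (Fin D)} {K : ℝ}

/-- Independence makes the variances of each coordinate add, and a variance is at most a second
moment. Summing over coordinates recombines the second moments into `E ‖z‖² ≤ K²`, so the dimension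
disappears. -/
theorem integral_sq_norm_mean_sub_le (hz : Measurable z) (hK : ∀ x, ‖z x‖ ≤ K) (hn : 1 ≤ n) :
    ∫ x, ‖(n : ℝ)⁻¹ • ∑ j, z (x j) - ∫ y, z y ∂ν‖ ^ 2 ∂(Measure.pi fun _ : Fin n => ν)
      ≤ K ^ 2 / n := by
  have hn' : (0 : ℝ) < n := by exact_mod_cast hn
  have hzi : Integrable z ν := Integrable.of_bound hz.aestronglyMeasurable K (.of_forall hK)
  have hcm : ∀ i, Measurable fun x => z x i := fun i => by fun_prop
  have hcK : ∀ i x, |z x i| ≤ K := fun i x => (PiLp.norm_apply_le (z x) i).trans (hK x)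
  have hsqi : ∀ i, Integrable (fun x => z x i ^ 2) ν := fun i =>
    integrable_of_abs_le (by fun_prop) (K := K ^ 2) fun x => by
      rw [abs_pow]
      exact pow_le_pow_left₀ (abs_nonneg _) (hcK i x) 2
  have hcoord : ∀ i, ∫ x, ((n : ℝ)⁻¹ * ∑ j, z (x j) i - ∫ y, z y i ∂ν) ^ 2
      ∂(Measure.pi fun _ : Fin n => ν) ≤ (n : ℝ)⁻¹ * ∫ y, z y i ^ 2 ∂ν := fun i => by
    have hL : MemLp (fun x => (n : ℝ)⁻¹ * z x i) 2 ν :=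
      (MemLp.of_bound (hcm i).aestronglyMeasurable K (.of_forall (hcK i))).const_mul _
    have h := variance_sum_pi (μ := fun _ : Fin n => ν) (X := fun _ x => (n : ℝ)⁻¹ * z x i)
      fun _ => hL
    have hmean : ∫ x, (∑ j : Fin n, fun x : Fin n → E => (n : ℝ)⁻¹ * z (x j) i) x
        ∂(Measure.pi fun _ : Fin n => ν) = ∫ y, z y i ∂ν := by
      simp only [Finset.sum_apply]
      rw [integral_finsetSum _ fun j _ => integrable_comp_eval (μ := fun _ : Fin n => ν) (i := j)
        (f := fun y => (n : ℝ)⁻¹ * z y i) (hL.integrable (by norm_num))]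
      have : ∀ j : Fin n, ∫ x, (n : ℝ)⁻¹ * z (x j) i ∂(Measure.pi fun _ : Fin n => ν)
          = (n : ℝ)⁻¹ * ∫ y, z y i ∂ν := fun j => by
        rw [integral_const_mul, integral_comp_eval (μ := fun _ : Fin n => ν)
          (f := fun y => z y i) (hcm i).aestronglyMeasurable]
      simp only [this, Finset.sum_const, Finset.card_univ, Fintype.card_fin, nsmul_eq_mul]
      field_simp
    rw [variance_eq_integral (by fun_prop), hmean] at h
    simp only [Finset.sum_apply, ← Finset.mul_sum] at h
    rw [h, variance_const_mul]
    simp only [Finset.sum_const, Finset.card_univ, Fintype.card_fin, nsmul_eq_mul]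
    have hv := variance_le_expectation_sq (X := fun x => z x i) (μ := ν)
      (hcm i).aestronglyMeasurable
    calc (n : ℝ) * ((n : ℝ)⁻¹ ^ 2 * Var[fun x => z x i; ν])
        = (n : ℝ)⁻¹ * Var[fun x => z x i; ν] := by field_simp
      _ ≤ _ := mul_le_mul_of_nonneg_left (by simpa using hv) (by positivity)
  have hnorm : ∀ x : Fin n → E, ‖(n : ℝ)⁻¹ • ∑ j, z (x j) - ∫ y, z y ∂ν‖ ^ 2
      = ∑ i, ((n : ℝ)⁻¹ * ∑ j, z (x j) i - ∫ y, z y i ∂ν) ^ 2 := fun x => by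
    rw [EuclideanSpace.real_norm_sq_eq]
    refine Finset.sum_congr rfl fun i _ => ?_
    rw [PiLp.sub_apply, integral_euclideanSpace_apply hzi]
    simp
  simp only [hnorm]
  rw [integral_finsetSum]
  · calc _ ≤ ∑ i, (n : ℝ)⁻¹ * ∫ y, z y i ^ 2 ∂ν := Finset.sum_le_sum fun i _ => hcoord i
      _ = (n : ℝ)⁻¹ * ∫ y, ‖z y‖ ^ 2 ∂ν := by
        rw [← Finset.mul_sum, ← integral_finsetSum _ fun i _ => hsqi i]
        simp only [EuclideanSpace.real_norm_sq_eq]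
      _ ≤ (n : ℝ)⁻¹ * K ^ 2 := by
        refine mul_le_mul_of_nonneg_left ?_ (by positivity)
        have := norm_integral_le_of_norm_le_const (μ := ν) (f := fun y => ‖z y‖ ^ 2) (C := K ^ 2)
          (.of_forall fun y => by
            rw [norm_pow, norm_norm]
            exact pow_le_pow_left₀ (norm_nonneg _) (hK y) 2)
        exact (le_abs_self _).trans (by simpa using this)
      _ = _ := by ring
  · intro i _
    refine integrable_of_abs_le (by fun_prop) (K := (K + K) ^ 2) fun x => ?_
    rw [abs_pow]
    refine pow_le_pow_left₀ (abs_nonneg _) ((abs_sub _ _).trans (add_le_add ?_ ?_)) 2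
    · rw [abs_mul, abs_inv, Nat.abs_cast, inv_mul_le_iff₀ hn']
      refine (Finset.abs_sum_le_sum_abs _ _).trans ?_
      simpa using Finset.sum_le_card_nsmul Finset.univ (fun j => |z (x j) i|) K fun j _ => hcK i _
    · have := norm_integral_le_of_norm_le_const (μ := ν) (f := fun y => z y i) (C := K)
        (.of_forall (hcK i))
      simpa using this

/-- A dimension-free concentration inequality for the mean of `n` bounded random vectors. -/
theorem measure_norm_mean_sub_ge_le (hz : Measurable z) (hK : ∀ x, ‖z x‖ ≤ K) (hK0 : 0 < K)
    (hn : 1 ≤ n) {s : ℝ} (hs : 0 ≤ s) :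
    (Measure.pi fun _ : Fin n => ν).real
        {x | K / Real.sqrt n + s ≤ ‖(n : ℝ)⁻¹ • ∑ j, z (x j) - ∫ y, z y ∂ν‖}
      ≤ Real.exp (-(n * s ^ 2 / (2 * K ^ 2))) := by
  have hn' : (0 : ℝ) < n := by exact_mod_cast hn
  set f : (Fin n → E) → ℝ := fun x => ‖(n : ℝ)⁻¹ • ∑ j, z (x j) - ∫ y, z y ∂ν‖ with hf
  have hfm : Measurable f := by fun_prop
  have hfK : ∀ x, |f x| ≤ K + K := fun x => by
    rw [hf, abs_norm]
    refine (norm_sub_le _ _).trans (add_le_add ?_ ?_)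
    · rw [norm_smul, norm_inv, Real.norm_natCast, inv_mul_le_iff₀ hn']
      refine (norm_sum_le _ _).trans ?_
      simpa using Finset.sum_le_card_nsmul Finset.univ (fun j => ‖z (x j)‖) K fun j _ => hK _
    · simpa using norm_integral_le_of_norm_le_const (μ := ν) (f := z) (C := K) (.of_forall hK)
  -- Replacing one sample changes only one summand of the mean, by a vector of norm at most `2K`.
  have hdiff : ∀ x i y, |f (Function.update x i y) - f x| ≤ 2 * K / n := fun x i y => by
    refine (abs_norm_sub_norm_le _ _).trans ?_
    rw [sub_sub_sub_cancel_right, ← smul_sub, ← Finset.sum_sub_distrib, Finset.sum_eq_single i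
      (fun j _ hj => by rw [Function.update_of_ne hj, sub_self]) (by simp), norm_smul, norm_inv,
      Real.norm_natCast, inv_mul_eq_div]
    gcongr
    exact (norm_sub_le _ _).trans (by linarith [hK (Function.update x i y i), hK (x i)])
  -- Jensen: `E f ≤ √(E f²)`.
  have hmean : ∫ x, f x ∂(Measure.pi fun _ : Fin n => ν) ≤ K / Real.sqrt n := by
    refine (abs_le_of_sq_le_sq' ?_ (by positivity)).2
    rw [div_pow, Real.sq_sqrt hn'.le]
    exact (sq_integral_le_integral_sq _ hfm hfK).trans (integral_sq_norm_mean_sub_le ν hz hK hn)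
  refine (measureReal_mono fun x hx => ?_).trans
    ((measure_ge_le_of_bounded_differences ν (c := 2 * K / n) (by positivity) hn hfm ⟨_, hfK⟩ hdiff
      hs).trans (le_of_eq ?_))
  · have hx' : K / Real.sqrt n + s ≤ f x := hx
    change (∫ x, f x ∂(Measure.pi fun _ : Fin n => ν)) + s ≤ f x
    linarith
  · congr 1
    field_simp

end VectorMean

/-! ### Discounted sums -/

section Discounted

variable {V : Type*} [NormedAddCommGroup V] [NormedSpace ℝ V] {γ K : ℝ} {v : ℕ → V}

theorem norm_discount_smul_le (hγ0 : 0 ≤ γ) (hv : ∀ t, ‖v t‖ ≤ K) (t : ℕ) :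
    ‖γ ^ t • v t‖ ≤ γ ^ t * K := by
  rw [norm_smul, Real.norm_of_nonneg (pow_nonneg hγ0 t)]
  exact mul_le_mul_of_nonneg_left (hv t) (pow_nonneg hγ0 t)

theorem summable_discount_smul [CompleteSpace V] (hγ0 : 0 ≤ γ) (hγ1 : γ < 1)
    (hv : ∀ t, ‖v t‖ ≤ K) : Summable fun t => γ ^ t • v t :=
  Summable.of_norm_bounded ((summable_geometric_of_lt_one hγ0 hγ1).mul_right K)
    (norm_discount_smul_le hγ0 hv)

/-- The weights `(1 - γ) γ^t` sum to `1`. -/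
theorem norm_discounted_sum_le [CompleteSpace V] (hγ0 : 0 ≤ γ) (hγ1 : γ < 1)
    (hv : ∀ t, ‖v t‖ ≤ K) : ‖(1 - γ) • ∑' t, γ ^ t • v t‖ ≤ K := by
  have h1 : 0 < 1 - γ := sub_pos.2 hγ1
  rw [norm_smul, Real.norm_of_nonneg h1.le]
  have h := tsum_of_norm_bounded ((hasSum_geometric_of_lt_one hγ0 hγ1).mul_right K)
    (norm_discount_smul_le hγ0 hv)
  calc (1 - γ) * ‖∑' t, γ ^ t • v t‖ ≤ (1 - γ) * ((1 - γ)⁻¹ * K) := by gcongr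
    _ = K := by field_simp

/-- The tail is `γ^T` times the discounted sum of the shifted sequence. -/
theorem norm_discounted_sum_sub_le [CompleteSpace V] (hγ0 : 0 ≤ γ) (hγ1 : γ < 1)
    (hv : ∀ t, ‖v t‖ ≤ K) (T : ℕ) :
    ‖(1 - γ) • ∑' t, γ ^ t • v t - (1 - γ) • ∑ t ∈ Finset.range T, γ ^ t • v t‖ ≤ γ ^ T * K := by
  rw [← smul_sub, ← (summable_discount_smul hγ0 hγ1 hv).sum_add_tsum_nat_add T,
    add_sub_cancel_left]
  have h : ∀ t, γ ^ (t + T) • v (t + T) = γ ^ T • (γ ^ t • v (t + T)) := fun t => by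
    rw [smul_smul, ← pow_add, add_comm]
  simp only [h]
  rw [tsum_const_smul'', smul_comm, norm_smul, Real.norm_of_nonneg (pow_nonneg hγ0 T)]
  exact mul_le_mul_of_nonneg_left (norm_discounted_sum_le hγ0 hγ1 fun t => hv (t + T))
    (pow_nonneg hγ0 T)

end Discounted

/-! ### Fourier features of trajectories -/

theorem norm_fourierFeature_le {d D : ℕ} (θ : Fin D → EuclideanSpace ℝ (Fin d) × ℝ)
    (x : EuclideanSpace ℝ (Fin d)) : ‖fourierFeature θ x‖ ≤ Real.sqrt 2 := by
  refine Real.le_sqrt_of_sq_le ?_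
  rw [EuclideanSpace.real_norm_sq_eq]
  have h : ∀ i ∈ Finset.univ, fourierFeature θ x i ^ 2 ≤ 2 / D := fun i _ => by
    simp only [fourierFeature, mul_pow]
    rw [Real.sq_sqrt (by positivity)]
    exact mul_le_of_le_one_right (by positivity) (Real.cos_sq_le_one _)
  refine (Finset.sum_le_card_nsmul _ _ _ h).trans ?_
  simp only [Finset.card_univ, Fintype.card_fin, nsmul_eq_mul]
  rw [← mul_div_assoc]
  -- This form also covers `D = 0`, where the quotient is `0` by convention.
  exact div_le_of_le_mul₀ (by positivity) (by norm_num) (mul_comm _ _).le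

theorem measurable_fourierFeature {d D : ℕ} :
    Measurable fun y : (Fin D → EuclideanSpace ℝ (Fin d) × ℝ) × EuclideanSpace ℝ (Fin d) =>
      fourierFeature y.1 y.2 := by
  refine (WithLp.measurable_toLp 2 _).comp (measurable_pi_iff.2 fun i => ?_)
  fun_prop

section Trajectories

variable {p q D n : ℕ} {S : Set (EuclideanSpace ℝ (Fin p))} {A : Set (EuclideanSpace ℝ (Fin q))}
  {γ : ℝ}

theorem norm_trajFeature_le (hγ0 : 0 ≤ γ) (hγ1 : γ < 1)
    (θ : Fin D → EuclideanSpace ℝ (Fin (p + q)) × ℝ) (τ : ℕ → S × A) :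
    ‖trajFeature γ θ τ‖ ≤ Real.sqrt 2 :=
  norm_discounted_sum_le hγ0 hγ1 fun _ => norm_fourierFeature_le _ _

theorem norm_trajFeature_sub_truncTrajFeature_le (hγ0 : 0 ≤ γ) (hγ1 : γ < 1) (T : ℕ)
    (θ : Fin D → EuclideanSpace ℝ (Fin (p + q)) × ℝ) (τ : ℕ → S × A) :
    ‖trajFeature γ θ τ - truncTrajFeature γ T θ τ‖ ≤ γ ^ T * Real.sqrt 2 :=
  norm_discounted_sum_sub_le hγ0 hγ1 (fun _ => norm_fourierFeature_le _ _) T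

theorem measurable_truncTrajFeature (γ : ℝ) (T : ℕ) :
    Measurable fun y : (Fin D → EuclideanSpace ℝ (Fin (p + q)) × ℝ) × (ℕ → S × A) =>
      truncTrajFeature γ T y.1 y.2 := by
  have hpair : ∀ t, Measurable fun y : (Fin D → EuclideanSpace ℝ (Fin (p + q)) × ℝ) ×
      (ℕ → S × A) => (y.1, concat (y.2 t)) := fun t => by
    have h : Measurable fun y : (Fin D → EuclideanSpace ℝ (Fin (p + q)) × ℝ) × (ℕ → S × A) =>
        y.2 t := by fun_prop
    exact measurable_fst.prodMk (measurable_concat.comp h)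
  have hφ : ∀ t, Measurable fun y : (Fin D → EuclideanSpace ℝ (Fin (p + q)) × ℝ) × (ℕ → S × A) =>
      fourierFeature y.1 (concat (y.2 t)) := fun t => by
    have h := measurable_fourierFeature.comp (hpair t)
    exact h
  unfold truncTrajFeature
  fun_prop

/-- A pointwise limit of truncated features. Joint measurability in features and trajectory is what
permits slicing the product space by the features. -/
theorem measurable_trajFeature (hγ0 : 0 ≤ γ) (hγ1 : γ < 1) :
    Measurable fun y : (Fin D → EuclideanSpace ℝ (Fin (p + q)) × ℝ) × (ℕ → S × A) =>
      trajFeature γ y.1 y.2 := by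
  refine measurable_of_tendsto_metrizable (measurable_truncTrajFeature γ) ?_
  refine tendsto_pi_nhds.2 fun y => ?_
  exact ((summable_discount_smul hγ0 hγ1
    fun _ => norm_fourierFeature_le _ _).hasSum.tendsto_sum_nat).const_smul _

theorem measurable_trajFeature_right (hγ0 : 0 ≤ γ) (hγ1 : γ < 1)
    (θ : Fin D → EuclideanSpace ℝ (Fin (p + q)) × ℝ) :
    Measurable (trajFeature (S := S) (A := A) γ θ) := by
  have h := (measurable_trajFeature (S := S) (A := A) (D := D) hγ0 hγ1).comp
    (measurable_prodMk_left (x := θ))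
  exact h

theorem integrable_trajFeature (hγ0 : 0 ≤ γ) (hγ1 : γ < 1) (ν : Measure (ℕ → S × A))
    [IsProbabilityMeasure ν] (θ : Fin D → EuclideanSpace ℝ (Fin (p + q)) × ℝ) :
    Integrable (trajFeature γ θ) ν :=
  Integrable.of_bound (measurable_trajFeature_right hγ0 hγ1 θ).aestronglyMeasurable _ (.of_forall (norm_trajFeature_le hγ0 hγ1 θ))

theorem norm_integral_trajFeature_sub_le (hγ0 : 0 ≤ γ) (hγ1 : γ < 1) (ν : Measure (ℕ → S × A))
    [IsProbabilityMeasure ν] (T : ℕ) (θ : Fin D → EuclideanSpace ℝ (Fin (p + q)) × ℝ) :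
    ‖(∫ τ, trajFeature γ θ τ ∂ν) - ∫ τ, truncTrajFeature γ T θ τ ∂ν‖ ≤ γ ^ T * Real.sqrt 2 := by
  have hz := integrable_trajFeature hγ0 hγ1 ν θ
  have hm : AEStronglyMeasurable (truncTrajFeature γ T θ) ν :=
    ((measurable_truncTrajFeature γ T).comp measurable_prodMk_left).aestronglyMeasurable
  have hd := norm_trajFeature_sub_truncTrajFeature_le (S := S) (A := A) hγ0 hγ1 T θ
  have hsub : Integrable (fun τ => trajFeature γ θ τ - truncTrajFeature γ T θ τ) ν :=
    Integrable.of_bound (hz.aestronglyMeasurable.sub hm) _ (.of_forall hd)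
  have hzT : Integrable (truncTrajFeature γ T θ) ν :=
    (hz.sub hsub).congr (.of_forall fun τ => by simp)
  rw [← integral_sub hz hzT]
  simpa using norm_integral_le_of_norm_le_const (μ := ν) (.of_forall hd)

theorem norm_embedding_sub_truncEmbedding_le (hγ0 : 0 ≤ γ) (hγ1 : γ < 1) (hn : 1 ≤ n) (T : ℕ)
    (θ : Fin D → EuclideanSpace ℝ (Fin (p + q)) × ℝ) (τ : Fin n → ℕ → S × A) :
    ‖embedding γ θ τ - truncEmbedding γ T θ τ‖ ≤ γ ^ T * Real.sqrt 2 := by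
  have hn' : (0 : ℝ) < n := by exact_mod_cast hn
  rw [embedding, truncEmbedding, ← smul_sub, ← Finset.sum_sub_distrib, norm_smul, norm_inv,
    Real.norm_natCast, inv_mul_le_iff₀ hn']
  refine (norm_sum_le _ _).trans ?_
  simpa using Finset.sum_le_card_nsmul Finset.univ
    (fun j => ‖trajFeature γ θ (τ j) - truncTrajFeature γ T θ (τ j)‖) (γ ^ T * Real.sqrt 2)
    fun j _ => norm_trajFeature_sub_truncTrajFeature_le hγ0 hγ1 T θ (τ j)

theorem norm_embedding_le (hγ0 : 0 ≤ γ) (hγ1 : γ < 1) (hn : 1 ≤ n)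
    (θ : Fin D → EuclideanSpace ℝ (Fin (p + q)) × ℝ) (τ : Fin n → ℕ → S × A) :
    ‖embedding γ θ τ‖ ≤ Real.sqrt 2 := by
  have hn' : (0 : ℝ) < n := by exact_mod_cast hn
  rw [embedding, norm_smul, norm_inv, Real.norm_natCast, inv_mul_le_iff₀ hn']
  refine (norm_sum_le _ _).trans ?_
  simpa using Finset.sum_le_card_nsmul Finset.univ (fun j => ‖trajFeature γ θ (τ j)‖) (Real.sqrt 2)
    fun j _ => norm_trajFeature_le hγ0 hγ1 θ (τ j)

end Trajectories

/-! ### Occupancy measures -/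

namespace MDP

variable {S A : Type*} [MeasurableSpace S] [MeasurableSpace A] (M : MDP S A) (π : Kernel S A)
  [IsMarkovKernel π]

instance isProbabilityMeasure_occupancy : IsProbabilityMeasure (M.occupancy π) := by
  have h1 : 0 < 1 - M.discount := sub_pos.2 M.discount_lt_one
  refine ⟨?_⟩
  have hmap : ∀ t : ℕ, (M.trajectoryLaw π).map (fun τ => τ t) Set.univ = 1 := fun t => by
    have := Measure.isProbabilityMeasure_map (μ := M.trajectoryLaw π)
      (measurable_pi_apply (X := fun _ : ℕ => S × A) t).aemeasurable
    exact measure_univ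
  rw [occupancy, Measure.sum_apply _ MeasurableSet.univ]
  simp only [Measure.smul_apply, hmap, smul_eq_mul, mul_one]
  rw [← ENNReal.ofReal_tsum_of_nonneg
    (fun t => mul_nonneg h1.le (pow_nonneg M.discount_pos.le t))
    ((summable_geometric_of_lt_one M.discount_pos.le M.discount_lt_one).mul_left _),
    tsum_mul_left, tsum_geometric_of_lt_one M.discount_pos.le M.discount_lt_one,
    mul_inv_cancel₀ h1.ne', ENNReal.ofReal_one]

/-- Geometric domination allows sum and integral to be exchanged, and both sides are then sums of
the same series. This is the bridge from trajectories to occupancy measures. -/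
theorem integral_discounted_sum {V : Type*} [NormedAddCommGroup V] [NormedSpace ℝ V]
    [CompleteSpace V] {g : S × A → V} (hg : StronglyMeasurable g) {K : ℝ} (hK : ∀ x, ‖g x‖ ≤ K) :
    ∫ τ, (1 - M.discount) • ∑' t : ℕ, M.discount ^ t • g (τ t) ∂(M.trajectoryLaw π)
      = ∫ x, g x ∂(M.occupancy π) := by
  have h1 : 0 < 1 - M.discount := sub_pos.2 M.discount_lt_one
  have hγ := M.discount_pos.le
  have hev : ∀ t, Measurable fun τ : ℕ → S × A => τ t := measurable_pi_apply
  have hint : ∀ t, Integrable (fun τ : ℕ → S × A => M.discount ^ t • g (τ t))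
      (M.trajectoryLaw π) := fun t =>
    (Integrable.of_bound (hg.comp_measurable (hev t)).aestronglyMeasurable K
      (.of_forall fun τ => hK _)).smul _
  have hsum := hasSum_integral_of_summable_integral_norm hint (by
    refine Summable.of_nonneg_of_le (fun t => integral_nonneg fun τ => norm_nonneg _)
      (fun t => ?_) ((summable_geometric_of_lt_one hγ M.discount_lt_one).mul_right K)
    have := norm_integral_le_of_norm_le_const (μ := M.trajectoryLaw π)
      (f := fun τ : ℕ → S × A => ‖M.discount ^ t • g (τ t)‖) (C := M.discount ^ t * K)
      (.of_forall fun τ => by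
        rw [norm_norm]
        exact norm_discount_smul_le hγ (fun t => hK (τ t)) t)
    exact (le_abs_self _).trans (by simpa using this))
  have hocc := hasSum_integral_measure (f := g) (μ := fun t : ℕ =>
      ENNReal.ofReal ((1 - M.discount) * M.discount ^ t) • (M.trajectoryLaw π).map (fun τ => τ t))
    (Integrable.of_bound (μ := M.occupancy π) hg.aestronglyMeasurable K (.of_forall hK))
  rw [integral_smul]
  refine (hsum.const_smul (1 - M.discount)).unique ?_
  unfold occupancy
  convert hocc using 2 with t
  rw [integral_smul_measure, integral_map (hev t).aemeasurable hg.aestronglyMeasurable,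
    ENNReal.toReal_ofReal (mul_nonneg h1.le (pow_nonneg hγ t)), integral_smul, smul_smul]

end MDP

/-! ### The MMD as an average over the features -/

instance isProbabilityMeasure_uniform_phase :
    IsProbabilityMeasure (cond (volume : Measure ℝ) (Set.Icc 0 (2 * Real.pi))) := by
  refine cond_isProbabilityMeasure_of_finite ?_ ?_
  · simp [Real.pi_pos]
  · rw [Real.volume_Icc]
    exact ENNReal.ofReal_ne_top

instance isProbabilityMeasure_featureLaw (d : ℕ) (σ : ℝ) :
    IsProbabilityMeasure (featureLaw d σ) := by
  unfold featureLaw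
  infer_instance

/-- The real part of the Gaussian characteristic function. -/
theorem integral_cos_inner_multivariateGaussian {d : ℕ} (σ : ℝ) (u : EuclideanSpace ℝ (Fin d)) :
    ∫ w, Real.cos (inner ℝ w u)
        ∂(multivariateGaussian 0 ((σ ^ 2)⁻¹ • (1 : Matrix (Fin d) (Fin d) ℝ)))
      = Real.exp (-‖u‖ ^ 2 / (2 * σ ^ 2)) := by
  have hS : ((σ ^ 2)⁻¹ • (1 : Matrix (Fin d) (Fin d) ℝ)).PosSemidef :=
    Matrix.PosSemidef.one.smul (by positivity)
  have h := congrArg Complex.re (charFun_multivariateGaussian (μ := 0) hS u)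
  rw [charFun_apply] at h
  have hint : Integrable (fun w => Complex.exp (((inner ℝ w u : ℝ) : ℂ) * Complex.I))
      (multivariateGaussian 0 ((σ ^ 2)⁻¹ • (1 : Matrix (Fin d) (Fin d) ℝ))) := by
    refine Integrable.of_bound (by fun_prop) 1 (.of_forall fun w => ?_)
    simp [Complex.norm_exp_ofReal_mul_I]
  have h3 := integral_re hint
  simp only [RCLike.re_eq_complex_re] at h3
  rw [← h3] at h
  simp only [Complex.exp_ofReal_mul_I_re] at h
  rw [h]
  have hdot : u.ofLp ⬝ᵥ ((σ ^ 2)⁻¹ • (1 : Matrix (Fin d) (Fin d) ℝ)).mulVec u.ofLp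
      = (σ ^ 2)⁻¹ * ‖u‖ ^ 2 := by
    rw [Matrix.smul_mulVec, Matrix.one_mulVec, dotProduct_smul, EuclideanSpace.real_norm_sq_eq]
    simp [dotProduct, sq]
  rw [hdot, inner_zero_right]
  have : ((0 : ℝ) : ℂ) * Complex.I - (((σ ^ 2)⁻¹ * ‖u‖ ^ 2 : ℝ) : ℂ) / 2
      = ((-‖u‖ ^ 2 / (2 * σ ^ 2) : ℝ) : ℂ) := by
    push_cast
    ring
  rw [this, Complex.exp_ofReal_re]

/-- The argument runs over two full periods. This removes the `cos (⟨w, x + y⟩ + 2b)` term from the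
product of two features. -/
theorem integral_cos_add_two_mul_uniform (c : ℝ) :
    ∫ b, Real.cos (c + 2 * b) ∂(cond (volume : Measure ℝ) (Set.Icc 0 (2 * Real.pi))) = 0 := by
  rw [ProbabilityTheory.cond, integral_smul_measure, integral_Icc_eq_integral_Ioc,
    ← intervalIntegral.integral_of_le (by positivity)]
  have h : ∫ b in (0 : ℝ)..(2 * Real.pi), Real.cos (c + 2 * b) = 0 := by
    rw [intervalIntegral.integral_comp_add_mul (fun x => Real.cos x) two_ne_zero, integral_cos]
    have : Real.sin (c + 2 * (2 * Real.pi)) = Real.sin c := by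
      simpa using Real.sin_add_nat_mul_two_pi c 2
    simp [this]
  rw [h, smul_zero]

/-- The Gaussian kernel is the average of the products of random Fourier features. -/
theorem integral_two_mul_cos_mul_cos_featureLaw {d : ℕ} (σ : ℝ)
    (x y : EuclideanSpace ℝ (Fin d)) :
    ∫ θ, 2 * (Real.cos (inner ℝ θ.1 x + θ.2) * Real.cos (inner ℝ θ.1 y + θ.2)) ∂(featureLaw d σ)
      = gaussianKernel σ x y := by
  have hprod : ∀ a b t : ℝ, 2 * (Real.cos (a + t) * Real.cos (b + t))
      = Real.cos (a - b) + Real.cos (a + b + 2 * t) := fun a b t => by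
    rw [show a - b = (a + t) - (b + t) by ring, show a + b + 2 * t = (a + t) + (b + t) by ring,
      Real.cos_sub (a + t), Real.cos_add (a + t)]
    ring
  have hcos : ∀ θ : EuclideanSpace ℝ (Fin d) × ℝ,
      2 * (Real.cos (inner ℝ θ.1 x + θ.2) * Real.cos (inner ℝ θ.1 y + θ.2))
        = Real.cos (inner ℝ θ.1 (x - y)) + Real.cos (inner ℝ θ.1 (x + y) + 2 * θ.2) := fun θ => by
    rw [inner_sub_right, inner_add_right, hprod]
  simp only [hcos]
  have hi1 : Integrable (fun θ : EuclideanSpace ℝ (Fin d) × ℝ => Real.cos (inner ℝ θ.1 (x - y)))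
      (featureLaw d σ) :=
    integrable_of_abs_le (by fun_prop) fun θ => Real.abs_cos_le_one _
  have hi2 : Integrable (fun θ : EuclideanSpace ℝ (Fin d) × ℝ =>
      Real.cos (inner ℝ θ.1 (x + y) + 2 * θ.2)) (featureLaw d σ) :=
    integrable_of_abs_le (by fun_prop) fun θ => Real.abs_cos_le_one _
  rw [integral_add hi1 hi2]
  unfold featureLaw at hi1 hi2 ⊢
  rw [integral_prod _ hi1, integral_prod _ hi2]
  simp only [integral_cos_add_two_mul_uniform, integral_const, probReal_univ, smul_eq_mul,
    one_mul, mul_zero, add_zero]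
  exact integral_cos_inner_multivariateGaussian σ (x - y)

/-- The mean of the cosine feature with parameter `θ = (w, b)` under `P`. -/
noncomputable def meanCos {d : ℕ} (P : Measure (EuclideanSpace ℝ (Fin d)))
    (θ : EuclideanSpace ℝ (Fin d) × ℝ) : ℝ :=
  ∫ x, Real.cos (inner ℝ θ.1 x + θ.2) ∂P

section MeanCos

variable {d : ℕ} (P Q : Measure (EuclideanSpace ℝ (Fin d))) [IsProbabilityMeasure P]
  [IsProbabilityMeasure Q]

theorem measurable_meanCos : Measurable (meanCos P) := by
  have : StronglyMeasurable (Function.uncurry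
      fun (θ : EuclideanSpace ℝ (Fin d) × ℝ) (x : EuclideanSpace ℝ (Fin d)) =>
        Real.cos (inner ℝ θ.1 x + θ.2)) := by
    refine Measurable.stronglyMeasurable ?_
    unfold Function.uncurry
    fun_prop
  exact this.integral_prod_right.measurable

theorem abs_meanCos_le_one (θ : EuclideanSpace ℝ (Fin d) × ℝ) : |meanCos P θ| ≤ 1 := by
  have h := norm_integral_le_of_norm_le_const (μ := P)
    (f := fun x => Real.cos (inner ℝ θ.1 x + θ.2)) (C := 1)
    (.of_forall fun x => Real.abs_cos_le_one _)
  rw [meanCos]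
  simpa only [Real.norm_eq_abs, probReal_univ, mul_one] using h

theorem norm_gaussianFeature (σ : ℝ) (x : EuclideanSpace ℝ (Fin d)) :
    ‖gaussianFeature σ x‖ = 1 := by
  have h := real_inner_self_eq_norm_sq (gaussianFeature σ x)
  rw [inner_gaussianFeature, gaussianKernel] at h
  rw [← Real.sqrt_sq (norm_nonneg (gaussianFeature σ x)), ← h]
  simp

/-- The distance in the Hilbert space is `√(2 - 2k)`. Continuity supplies the strong measurability
behind the Bochner integrals. -/
theorem continuous_gaussianFeature (σ : ℝ) :
    Continuous (gaussianFeature σ : EuclideanSpace ℝ (Fin d) → GaussianRKHS d σ) := by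
  refine continuous_iff_continuousAt.2 fun x => ?_
  rw [ContinuousAt, tendsto_iff_norm_sub_tendsto_zero]
  have hsq : ∀ y, ‖gaussianFeature σ y - gaussianFeature σ x‖
      = Real.sqrt (2 - 2 * gaussianKernel σ y x) := fun y => by
    rw [← Real.sqrt_sq (norm_nonneg (gaussianFeature σ y - gaussianFeature σ x)),
      norm_sub_sq_real, norm_gaussianFeature, norm_gaussianFeature, inner_gaussianFeature]
    congr 1
    ring
  simp only [hsq]
  have hc : Continuous fun y => Real.sqrt (2 - 2 * gaussianKernel σ y x) := by
    unfold gaussianKernel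
    fun_prop
  have := hc.tendsto x
  simpa [gaussianKernel] using this

theorem integrable_gaussianFeature (σ : ℝ) : Integrable (gaussianFeature σ) P :=
  Integrable.of_bound (continuous_gaussianFeature σ).aestronglyMeasurable 1
    (.of_forall fun x => (norm_gaussianFeature σ x).le)

/-- Two applications of Fubini to the feature expansion of the kernel turn the Hilbert space inner
product of mean embeddings into an `L²` product over the feature law. -/
theorem inner_integral_gaussianFeature (σ : ℝ) :
    inner ℝ (∫ x, gaussianFeature σ x ∂P) (∫ y, gaussianFeature σ y ∂Q)
      = ∫ θ, 2 * (meanCos P θ * meanCos Q θ) ∂(featureLaw d σ) := by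
  have hQ : ∀ x, inner ℝ (gaussianFeature σ x) (∫ y, gaussianFeature σ y ∂Q)
      = ∫ θ, 2 * (Real.cos (inner ℝ θ.1 x + θ.2) * meanCos Q θ) ∂(featureLaw d σ) := fun x => by
    rw [← integral_inner (integrable_gaussianFeature Q σ)]
    simp only [inner_gaussianFeature, ← integral_two_mul_cos_mul_cos_featureLaw]
    rw [integral_integral_swap]
    · refine integral_congr_ae (.of_forall fun θ => ?_)
      simp only [integral_const_mul, meanCos]
    · refine integrable_of_abs_le (by unfold Function.uncurry; fun_prop) (K := 2) fun z => ?_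
      rw [Function.uncurry, abs_mul, abs_mul, abs_two]
      nlinarith [abs_nonneg (Real.cos (inner ℝ z.2.1 x + z.2.2)),
        abs_nonneg (Real.cos (inner ℝ z.2.1 z.1 + z.2.2)),
        Real.abs_cos_le_one (inner ℝ z.2.1 x + z.2.2),
        Real.abs_cos_le_one (inner ℝ z.2.1 z.1 + z.2.2)]
  rw [real_inner_comm, ← integral_inner (integrable_gaussianFeature P σ)]
  simp only [real_inner_comm (gaussianFeature σ _), hQ]
  have hmQ := measurable_meanCos Q
  rw [integral_integral_swap]
  · refine integral_congr_ae (.of_forall fun θ => ?_)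
    simp only [integral_const_mul, integral_mul_const, meanCos]
  · refine integrable_of_abs_le (by unfold Function.uncurry; fun_prop) (K := 2) fun z => ?_
    rw [Function.uncurry, abs_mul, abs_mul, abs_two]
    nlinarith [abs_nonneg (Real.cos (inner ℝ z.2.1 z.1 + z.2.2)),
      abs_nonneg (meanCos Q z.2), Real.abs_cos_le_one (inner ℝ z.2.1 z.1 + z.2.2),
      abs_meanCos_le_one Q z.2]

theorem abs_meanCos_sub_le_two (θ : EuclideanSpace ℝ (Fin d) × ℝ) :
    |meanCos P θ - meanCos Q θ| ≤ 2 :=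
  (abs_sub _ _).trans (by linarith [abs_meanCos_le_one P θ, abs_meanCos_le_one Q θ])

/-- The splitting `2 = 8 / 4` normalizes the integrand to `[0, 1]`, as the Chernoff bound requires.
-/
theorem gaussianMMD_sq (σ : ℝ) :
    gaussianMMD σ P Q ^ 2
      = 8 * ∫ θ, (meanCos P θ - meanCos Q θ) ^ 2 / 4 ∂(featureLaw d σ) := by
  have hi : ∀ P Q : Measure (EuclideanSpace ℝ (Fin d)), IsProbabilityMeasure P →
      IsProbabilityMeasure Q →
      Integrable (fun θ => 2 * (meanCos P θ * meanCos Q θ)) (featureLaw d σ) := by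
    intro P Q _ _
    have hP := measurable_meanCos P
    have hQ := measurable_meanCos Q
    refine integrable_of_abs_le (by fun_prop) (K := 2) fun θ => ?_
    rw [abs_mul, abs_mul, abs_two]
    nlinarith [abs_nonneg (meanCos P θ), abs_nonneg (meanCos Q θ), abs_meanCos_le_one P θ,
      abs_meanCos_le_one Q θ]
  rw [gaussianMMD, norm_sub_sq_real, ← real_inner_self_eq_norm_sq, ← real_inner_self_eq_norm_sq]
  simp only [inner_integral_gaussianFeature]
  have hsub := (hi P P ‹_› ‹_›).sub ((hi P Q ‹_› ‹_›).const_mul 2)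
  simp only [Pi.sub_def] at hsub
  rw [← integral_const_mul, ← integral_const_mul, ← integral_sub (hi P P ‹_› ‹_›)
    ((hi P Q ‹_› ‹_›).const_mul 2), ← integral_add hsub (hi Q Q ‹_› ‹_›)]
  refine integral_congr_ae (.of_forall fun θ => ?_)
  ring

end MeanCos

/-! ### The two error terms -/

theorem measureReal_prod_le_of_slices {X Y : Type*} [MeasurableSpace X] [MeasurableSpace Y]
    (μ : Measure X) (ν : Measure Y) [IsProbabilityMeasure μ] [IsProbabilityMeasure ν]
    {s : Set (X × Y)} (hs : MeasurableSet s) {c : ℝ} (hc : 0 ≤ c)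
    (h : ∀ x, ν.real (Prod.mk x ⁻¹' s) ≤ c) : (μ.prod ν).real s ≤ c := by
  refine ENNReal.toReal_le_of_le_ofReal hc ?_
  rw [Measure.prod_apply hs]
  calc ∫⁻ x, ν (Prod.mk x ⁻¹' s) ∂μ ≤ ∫⁻ _, ENNReal.ofReal c ∂μ :=
        lintegral_mono fun x => (ENNReal.le_ofReal_iff_toReal_le (measure_ne_top _ _) hc).2 (h x)
    _ = ENNReal.ofReal c := by simp

section Errors

variable {p q D n : ℕ} {S : Set (EuclideanSpace ℝ (Fin p))} {A : Set (EuclideanSpace ℝ (Fin q))}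
  (M : MDP S A) (π π₁ π₂ : Kernel S A) [IsMarkovKernel π] [IsMarkovKernel π₁] [IsMarkovKernel π₂]
  (σ : ℝ)

instance isProbabilityMeasure_map_concat_occupancy :
    IsProbabilityMeasure ((M.occupancy π).map concat) :=
  Measure.isProbabilityMeasure_map measurable_concat.aemeasurable

theorem integral_trajFeature_apply (θ : Fin D → EuclideanSpace ℝ (Fin (p + q)) × ℝ) (i : Fin D) :
    (∫ τ, trajFeature M.discount θ τ ∂(M.trajectoryLaw π)) i
      = Real.sqrt (2 / D) * meanCos ((M.occupancy π).map concat) (θ i) := by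
  have hm : Measurable (fourierFeature θ) := by
    have h := (measurable_fourierFeature (d := p + q) (D := D)).comp
      (measurable_prodMk_left (x := θ))
    exact h
  have h := M.integral_discounted_sum π (g := fun x => fourierFeature θ (concat x))
    (hm.comp measurable_concat).stronglyMeasurable fun x => norm_fourierFeature_le θ _
  rw [← integral_map measurable_concat.aemeasurable hm.aestronglyMeasurable] at h
  simp only [trajFeature]
  rw [h, integral_euclideanSpace_apply (Integrable.of_bound hm.aestronglyMeasurable _
    (.of_forall (norm_fourierFeature_le θ)))]
  simp only [fourierFeature, integral_const_mul]
  rfl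

/-- The empirical counterpart of `gaussianMMD_eq_sqrt`: an average over the drawn features replaces
the expectation. -/
theorem norm_integral_trajFeature_sub (θ : Fin D → EuclideanSpace ℝ (Fin (p + q)) × ℝ) :
    ‖(∫ τ, trajFeature M.discount θ τ ∂(M.trajectoryLaw π₁))
        - ∫ τ, trajFeature M.discount θ τ ∂(M.trajectoryLaw π₂)‖
      = Real.sqrt 8 * Real.sqrt ((∑ i, (meanCos ((M.occupancy π₁).map concat) (θ i)
          - meanCos ((M.occupancy π₂).map concat) (θ i)) ^ 2 / 4) / D) := by
  rw [← Real.sqrt_mul (by norm_num), ← Real.sqrt_sq (norm_nonneg (_ - _)),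
    EuclideanSpace.real_norm_sq_eq]
  congr 1
  simp only [PiLp.sub_apply, integral_trajFeature_apply, ← mul_sub, mul_pow]
  rw [← Finset.mul_sum, ← Finset.sum_div, Real.sq_sqrt (by positivity)]
  ring

theorem gaussianMMD_eq_sqrt {d : ℕ} (P Q : Measure (EuclideanSpace ℝ (Fin d)))
    [IsProbabilityMeasure P] [IsProbabilityMeasure Q] :
    gaussianMMD σ P Q = Real.sqrt 8 *
      Real.sqrt (∫ θ, (meanCos P θ - meanCos Q θ) ^ 2 / 4 ∂(featureLaw d σ)) := by
  have h0 : 0 ≤ gaussianMMD σ P Q := norm_nonneg _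
  rw [← Real.sqrt_mul (by norm_num), ← gaussianMMD_sq, Real.sqrt_sq h0]

theorem sq_meanCos_sub_div_four_mem_Icc {d : ℕ} (P Q : Measure (EuclideanSpace ℝ (Fin d)))
    [IsProbabilityMeasure P] [IsProbabilityMeasure Q] (θ : EuclideanSpace ℝ (Fin d) × ℝ) :
    (meanCos P θ - meanCos Q θ) ^ 2 / 4 ∈ Set.Icc (0 : ℝ) 1 := by
  have h := pow_le_pow_left₀ (abs_nonneg _) (abs_meanCos_sub_le_two P Q θ) 2
  rw [sq_abs] at h
  exact ⟨by positivity, by linarith⟩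

theorem gaussianMMD_le {d : ℕ} (P Q : Measure (EuclideanSpace ℝ (Fin d)))
    [IsProbabilityMeasure P] [IsProbabilityMeasure Q] : gaussianMMD σ P Q ≤ Real.sqrt 8 := by
  rw [gaussianMMD_eq_sqrt]
  refine mul_le_of_le_one_right (Real.sqrt_nonneg _) (Real.sqrt_le_one.2 ?_)
  have h := norm_integral_le_of_norm_le_const (μ := featureLaw d σ)
    (f := fun θ => (meanCos P θ - meanCos Q θ) ^ 2 / 4) (C := 1) (.of_forall fun θ => by
      have h := sq_meanCos_sub_div_four_mem_Icc P Q θ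
      rw [Real.norm_of_nonneg h.1]
      exact h.2)
  exact (le_abs_self _).trans (by simpa using h)

theorem measure_abs_sqrt_mean_sub_gaussianMMD_ge_le {d : ℕ}
    (P Q : Measure (EuclideanSpace ℝ (Fin d))) [IsProbabilityMeasure P] [IsProbabilityMeasure Q]
    (hD : 1 ≤ D) {ε : ℝ} (hε : 0 < ε) :
    (Measure.pi fun _ : Fin D => featureLaw d σ).real {θ | ε / 2 ≤
        |Real.sqrt 8 * Real.sqrt ((∑ i, (meanCos P (θ i) - meanCos Q (θ i)) ^ 2 / 4) / D)
          - gaussianMMD σ P Q|}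
      ≤ 2 * Real.exp (-(D * ε ^ 2 / 128)) := by
  have h8 : 0 < Real.sqrt 8 := by positivity
  have hP := measurable_meanCos P
  have hQ := measurable_meanCos Q
  have hY : Measurable fun θ => (meanCos P θ - meanCos Q θ) ^ 2 / 4 := by fun_prop
  -- Undoing the factor `√8` makes this the deviation of the square roots.
  have hs : 0 < ε / (2 * Real.sqrt 8) := by positivity
  have h := measure_abs_sqrt_mean_sub_sqrt_ge_le (featureLaw d σ) hY
    (sq_meanCos_sub_div_four_mem_Icc P Q) hD hs
  have hexp : (D : ℝ) * (ε / (2 * Real.sqrt 8)) ^ 2 / 4 = D * ε ^ 2 / 128 := by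
    rw [div_pow, mul_pow, Real.sq_sqrt (by norm_num)]
    ring
  rw [hexp] at h
  refine (measureReal_mono fun θ hθ => ?_).trans h
  rw [Set.mem_ofPred_eq, gaussianMMD_eq_sqrt, ← mul_sub, abs_mul, abs_of_pos h8] at hθ
  rw [Set.mem_ofPred_eq, div_le_iff₀ (by positivity)]
  linarith

/-- Concentration of the norm of the mean embedding difference around the MMD. -/
theorem measure_abs_norm_integral_sub_gaussianMMD_ge_le (hD : 1 ≤ D) {ε : ℝ} (hε : 0 < ε) :
    (Measure.pi fun _ : Fin D => featureLaw (p + q) σ).real {θ | ε / 2 ≤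
        |‖(∫ τ, trajFeature M.discount θ τ ∂(M.trajectoryLaw π₁))
            - ∫ τ, trajFeature M.discount θ τ ∂(M.trajectoryLaw π₂)‖
          - gaussianMMD σ ((M.occupancy π₁).map concat) ((M.occupancy π₂).map concat)|}
      ≤ 2 * Real.exp (-(D * ε ^ 2 / 128)) := by
  simp only [norm_integral_trajFeature_sub]
  exact measure_abs_sqrt_mean_sub_gaussianMMD_ge_le σ _ _ hD hε

/-- Concentration of the empirical embedding around its mean. -/
theorem measure_norm_embedding_sub_ge_le (hn : 1 ≤ n) {ε : ℝ} (hε : 0 < ε)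
    (hnε : 128 ≤ n * ε ^ 2) (θ : Fin D → EuclideanSpace ℝ (Fin (p + q)) × ℝ) :
    (Measure.pi fun _ : Fin n => M.trajectoryLaw π).real {τ | 9 / 8 * ε ≤
        ‖embedding M.discount θ τ - ∫ τ, trajFeature M.discount θ τ ∂(M.trajectoryLaw π)‖}
      ≤ Real.exp (-(n * ε ^ 2 / 4)) := by
  have hn' : (0 : ℝ) < n := by exact_mod_cast hn
  have hz : Measurable (trajFeature (S := S) (A := A) M.discount θ) :=
    measurable_trajFeature_right M.discount_pos.le M.discount_lt_one θ
  have h2 : 0 < Real.sqrt 2 := by positivity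
  have hK : ∀ τ : ℕ → S × A, ‖trajFeature M.discount θ τ‖ ≤ Real.sqrt 2 :=
    norm_trajFeature_le M.discount_pos.le M.discount_lt_one θ
  have h := measure_norm_mean_sub_ge_le (M.trajectoryLaw π) hz hK h2 hn hε.le
  have hexp : (n : ℝ) * ε ^ 2 / (2 * Real.sqrt 2 ^ 2) = n * ε ^ 2 / 4 := by
    rw [Real.sq_sqrt (by norm_num)]
    norm_num
  rw [hexp] at h
  -- The threshold `128` is what makes the mean deviation at most `ε / 8`, whence `9/8 = 1 + 1/8`.
  have hsqrt : Real.sqrt 2 / Real.sqrt n ≤ ε / 8 := by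
    refine (abs_le_of_sq_le_sq' ?_ (by positivity)).2
    rw [div_pow, div_pow, Real.sq_sqrt (by norm_num), Real.sq_sqrt hn'.le,
      div_le_div_iff₀ hn' (by norm_num)]
    linarith
  refine (measureReal_mono fun τ hτ => ?_).trans h
  have hτ' : 9 / 8 * ε ≤ ‖embedding M.discount θ τ
    - ∫ τ, trajFeature M.discount θ τ ∂(M.trajectoryLaw π)‖ := hτ
  rw [embedding] at hτ'
  rw [Set.mem_ofPred_eq]
  linarith

theorem measurable_norm_embedding_sub :
    Measurable fun y : (Fin D → EuclideanSpace ℝ (Fin (p + q)) × ℝ) × (Fin n → ℕ → S × A) =>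
      ‖embedding M.discount y.1 y.2
        - ∫ τ, trajFeature M.discount y.1 τ ∂(M.trajectoryLaw π)‖ := by
  have hz := measurable_trajFeature (p := p) (q := q) (D := D) (S := S) (A := A)
    M.discount_pos.le M.discount_lt_one
  have hm : Measurable fun θ : Fin D → EuclideanSpace ℝ (Fin (p + q)) × ℝ =>
      ∫ τ, trajFeature M.discount θ τ ∂(M.trajectoryLaw π) := by
    have h : StronglyMeasurable (Function.uncurry
        (trajFeature (S := S) (A := A) (D := D) M.discount)) := hz.stronglyMeasurable
    exact h.integral_prod_right.measurable
  have hj : ∀ j, Measurable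
      fun y : (Fin D → EuclideanSpace ℝ (Fin (p + q)) × ℝ) × (Fin n → ℕ → S × A) =>
        trajFeature M.discount y.1 (y.2 j) := fun j => by
    have h := hz.comp (measurable_fst.prodMk ((measurable_pi_apply j).comp
      (measurable_snd (α := Fin D → EuclideanSpace ℝ (Fin (p + q)) × ℝ)
        (β := Fin n → ℕ → S × A))))
    exact h
  have he : Measurable
      fun y : (Fin D → EuclideanSpace ℝ (Fin (p + q)) × ℝ) × (Fin n → ℕ → S × A) =>
        embedding M.discount y.1 y.2 := by
    unfold embedding
    fun_prop
  exact (he.sub (hm.comp measurable_fst)).norm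

/-- A union bound over one feature event and two sampling events, with `11/4 = 1/2 + 9/8 + 9/8`. -/
theorem sample_measure_ge_le (hn : 1 ≤ n) (hD : 1 ≤ D) {ε : ℝ} (hε : 0 < ε)
    (hnε : 128 ≤ n * ε ^ 2) :
    ((Measure.pi fun _ : Fin D => featureLaw (p + q) σ).prod
      ((Measure.pi fun _ : Fin n => M.trajectoryLaw π₁).prod
        (Measure.pi fun _ : Fin n => M.trajectoryLaw π₂))).real
      {y | 11 / 4 * ε ≤ |‖embedding M.discount y.1 y.2.1 - embedding M.discount y.1 y.2.2‖
        - gaussianMMD σ ((M.occupancy π₁).map concat) ((M.occupancy π₂).map concat)|}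
      ≤ 2 * Real.exp (-(D * ε ^ 2 / 128)) + 2 * Real.exp (-(n * ε ^ 2 / 4)) := by
  set m₁ : (Fin D → EuclideanSpace ℝ (Fin (p + q)) × ℝ) → EuclideanSpace ℝ (Fin D) :=
    fun θ => ∫ τ, trajFeature M.discount θ τ ∂(M.trajectoryLaw π₁) with hm₁
  set m₂ : (Fin D → EuclideanSpace ℝ (Fin (p + q)) × ℝ) → EuclideanSpace ℝ (Fin D) :=
    fun θ => ∫ τ, trajFeature M.discount θ τ ∂(M.trajectoryLaw π₂) with hm₂
  set Θ := Measure.pi fun _ : Fin D => featureLaw (p + q) σ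
  set T₁ := Measure.pi fun _ : Fin n => M.trajectoryLaw π₁
  set T₂ := Measure.pi fun _ : Fin n => M.trajectoryLaw π₂
  set b := gaussianMMD σ ((M.occupancy π₁).map concat) ((M.occupancy π₂).map concat)
  set F : Set (Fin D → EuclideanSpace ℝ (Fin (p + q)) × ℝ) :=
    {θ | ε / 2 ≤ |‖m₁ θ - m₂ θ‖ - b|} with hF
  set B₁ : Set ((Fin D → EuclideanSpace ℝ (Fin (p + q)) × ℝ) ×
      (Fin n → ℕ → S × A) × (Fin n → ℕ → S × A)) :=
    {y | 9 / 8 * ε ≤ ‖embedding M.discount y.1 y.2.1 - m₁ y.1‖} with hB₁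
  set B₂ : Set ((Fin D → EuclideanSpace ℝ (Fin (p + q)) × ℝ) ×
      (Fin n → ℕ → S × A) × (Fin n → ℕ → S × A)) :=
    {y | 9 / 8 * ε ≤ ‖embedding M.discount y.1 y.2.2 - m₂ y.1‖} with hB₂
  have hF_le : (Θ.prod (T₁.prod T₂)).real (F ×ˢ Set.univ)
      ≤ 2 * Real.exp (-(D * ε ^ 2 / 128)) := by
    rw [measureReal_prod_prod, probReal_univ, mul_one]
    exact measure_abs_norm_integral_sub_gaussianMMD_ge_le M π₁ π₂ σ hD hε
  have hB₁_le : (Θ.prod (T₁.prod T₂)).real B₁ ≤ Real.exp (-(n * ε ^ 2 / 4)) := by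
    refine measureReal_prod_le_of_slices _ _ ?_ (Real.exp_pos _).le fun θ => ?_
    · have h := (measurable_norm_embedding_sub (D := D) (n := n) M π₁).comp
        (measurable_fst.prodMk (measurable_fst.comp measurable_snd) :
          Measurable fun y : (Fin D → EuclideanSpace ℝ (Fin (p + q)) × ℝ) ×
            (Fin n → ℕ → S × A) × (Fin n → ℕ → S × A) => (y.1, y.2.1))
      exact measurableSet_le measurable_const h
    · have : Prod.mk θ ⁻¹' B₁
          = {τ | 9 / 8 * ε ≤ ‖embedding M.discount θ τ - m₁ θ‖} ×ˢ Set.univ := by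
        ext y
        simp [hB₁]
      rw [this, measureReal_prod_prod, probReal_univ, mul_one]
      exact measure_norm_embedding_sub_ge_le M π₁ hn hε hnε θ
  have hB₂_le : (Θ.prod (T₁.prod T₂)).real B₂ ≤ Real.exp (-(n * ε ^ 2 / 4)) := by
    refine measureReal_prod_le_of_slices _ _ ?_ (Real.exp_pos _).le fun θ => ?_
    · have h := (measurable_norm_embedding_sub (D := D) (n := n) M π₂).comp
        (measurable_fst.prodMk (measurable_snd.comp measurable_snd) :
          Measurable fun y : (Fin D → EuclideanSpace ℝ (Fin (p + q)) × ℝ) ×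
            (Fin n → ℕ → S × A) × (Fin n → ℕ → S × A) => (y.1, y.2.2))
      exact measurableSet_le measurable_const h
    · have : Prod.mk θ ⁻¹' B₂
          = Set.univ ×ˢ {τ | 9 / 8 * ε ≤ ‖embedding M.discount θ τ - m₂ θ‖} := by
        ext y
        simp [hB₂]
      rw [this, measureReal_prod_prod, probReal_univ, one_mul]
      exact measure_norm_embedding_sub_ge_le M π₂ hn hε hnε θ
  refine (measureReal_mono (s₂ := F ×ˢ Set.univ ∪ (B₁ ∪ B₂)) fun y hy => ?_).trans
    ((measureReal_union_le _ _).trans ((add_le_add hF_le ((measureReal_union_le _ _).trans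
      (add_le_add hB₁_le hB₂_le))).trans (le_of_eq (by ring))))
  by_contra hcon
  simp only [hF, hB₁, hB₂, Set.mem_union, Set.mem_prod, Set.mem_univ, and_true, Set.mem_ofPred_eq,
    not_or, not_le] at hcon
  obtain ⟨h1, h2, h3⟩ := hcon
  have hy' : 11 / 4 * ε
    ≤ |‖embedding M.discount y.1 y.2.1 - embedding M.discount y.1 y.2.2‖ - b| := hy
  have h4 := abs_norm_sub_norm_le (embedding M.discount y.1 y.2.1 - embedding M.discount y.1 y.2.2)
    (m₁ y.1 - m₂ y.1)
  rw [sub_sub_sub_comm] at h4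
  have h5 := norm_sub_le (embedding M.discount y.1 y.2.1 - m₁ y.1)
    (embedding M.discount y.1 y.2.2 - m₂ y.1)
  have h6 := abs_sub_le ‖embedding M.discount y.1 y.2.1 - embedding M.discount y.1 y.2.2‖
    ‖m₁ y.1 - m₂ y.1‖ b
  linarith

end Errors

/-! ### The tail bound -/

/-- The last summand alone suffices, since `8 e⁻² ≥ 1`. -/
theorem one_le_tailBound {n D d : ℕ} {ε : ℝ} (hnε : n * ε ^ 2 ≤ 128) :
    1 ≤ tailBound 1 8 n D d ε := by
  have h : (1 : ℝ) ≤ 8 * Real.exp (-(n * ε ^ 2) / 64) := by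
    have h1 : Real.exp (-2) ≤ Real.exp (-(n * ε ^ 2) / 64) := Real.exp_le_exp.2 (by linarith)
    have h2 : Real.exp 2 ≤ 8 := by
      have : Real.exp 2 = Real.exp 1 ^ 2 := by rw [← Real.exp_nat_mul]; norm_num
      rw [this]
      nlinarith [Real.exp_one_lt_d9, Real.exp_pos 1]
    have h3 : Real.exp (-2) * Real.exp 2 = 1 := by rw [← Real.exp_add]; simp
    nlinarith [Real.exp_pos (-2)]
  unfold tailBound
  have h1 : 0 ≤ 2 * Real.exp (-(n * 1 * ε ^ 2)) := by positivity
  have h2 : 0 ≤ 8 * (1 / ε ^ 2 * Real.exp (-(D * ε ^ 2) / (64 * (d + 2)))) := by positivity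
  have h3 : 0 ≤ 6 * Real.exp (-(n * ε ^ 2) / 8) := by positivity
  linarith

/-- For `ε ≤ 2` one has `1/ε² ≥ 1/4`, so `C = 8` pays for the factor `2`; and `64 (d + 2) ≥ 128`.
The sampling error fits under the third summand. -/
theorem error_sum_le_tailBound {n D d : ℕ} {ε : ℝ} (hε : 0 < ε) (hε2 : ε ≤ 2) :
    2 * Real.exp (-(D * ε ^ 2 / 128)) + 2 * Real.exp (-(n * ε ^ 2 / 4))
      ≤ tailBound 1 8 n D d ε := by
  have hA : 2 * Real.exp (-(D * ε ^ 2 / 128))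
      ≤ 8 * (1 / ε ^ 2 * Real.exp (-(D * ε ^ 2) / (64 * (d + 2)))) := by
    have h1 : Real.exp (-(D * ε ^ 2 / 128)) ≤ Real.exp (-(D * ε ^ 2) / (64 * (d + 2))) := by
      rw [Real.exp_le_exp, neg_div, neg_le_neg_iff]
      refine div_le_div_of_nonneg_left (by positivity) (by norm_num) ?_
      have : (0 : ℝ) ≤ d := by positivity
      linarith
    have h2 : 1 / 4 ≤ 1 / ε ^ 2 := by
      refine one_div_le_one_div_of_le (by positivity) ?_
      nlinarith
    calc 2 * Real.exp (-(D * ε ^ 2 / 128))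
        = 8 * (1 / 4 * Real.exp (-(D * ε ^ 2 / 128))) := by ring
      _ ≤ _ := by gcongr
  have hB : Real.exp (-(n * ε ^ 2 / 4)) ≤ Real.exp (-(n * ε ^ 2) / 8) := by
    rw [Real.exp_le_exp]
    have : 0 ≤ n * ε ^ 2 := by positivity
    linarith
  unfold tailBound
  have h1 : 0 ≤ 2 * Real.exp (-(n * 1 * ε ^ 2)) := by positivity
  have h2 : 0 ≤ Real.exp (-(n * ε ^ 2) / 8) := by positivity
  have h3 : 0 ≤ 8 * Real.exp (-(n * ε ^ 2) / 64) := by positivity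
  linarith

/-! ### Assembly of the tail bounds -/

section Main

variable {p q D n : ℕ} {S : Set (EuclideanSpace ℝ (Fin p))} {A : Set (EuclideanSpace ℝ (Fin q))}
  (M : MDP S A) (π₁ π₂ : Kernel S A) [IsMarkovKernel π₁] [IsMarkovKernel π₂] (σ : ℝ)

/-- Both quantities are nonnegative and at most `2√2 = √8`. As `3 < 11/2`, the deviation event is
empty for `ε > 2`. -/
theorem abs_norm_embedding_sub_sub_gaussianMMD_le (hn : 1 ≤ n)
    (θ : Fin D → EuclideanSpace ℝ (Fin (p + q)) × ℝ) (τ₁ τ₂ : Fin n → ℕ → S × A) :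
    |‖embedding M.discount θ τ₁ - embedding M.discount θ τ₂‖
      - gaussianMMD σ ((M.occupancy π₁).map concat) ((M.occupancy π₂).map concat)| ≤ 3 := by
  have h1 := norm_sub_le (embedding M.discount θ τ₁) (embedding M.discount θ τ₂)
  have h2 := norm_embedding_le M.discount_pos.le M.discount_lt_one hn θ τ₁
  have h3 := norm_embedding_le M.discount_pos.le M.discount_lt_one hn θ τ₂
  have h4 := gaussianMMD_le σ ((M.occupancy π₁).map concat) ((M.occupancy π₂).map concat)
  have h5 : 0 ≤ gaussianMMD σ ((M.occupancy π₁).map concat) ((M.occupancy π₂).map concat) :=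
    norm_nonneg _
  have h6 := norm_nonneg (embedding M.discount θ τ₁ - embedding M.discount θ τ₂)
  have h7 : Real.sqrt 8 ≤ 3 := Real.sqrt_le_iff.2 (by norm_num)
  have h8 : Real.sqrt 2 ≤ 3 / 2 := Real.sqrt_le_iff.2 (by norm_num)
  exact abs_le.2 ⟨by linarith, by linarith⟩

theorem infinite_horizon_tail_le (hn : 1 ≤ n) (hD : 1 ≤ D) {ε : ℝ} (hε : 0 < ε) {Ω : Type*}
    [MeasurableSpace Ω] (μ : Measure Ω) [IsProbabilityMeasure μ]
    (θ : Ω → Fin D → EuclideanSpace ℝ (Fin (p + q)) × ℝ) (τ₁ τ₂ : Ω → Fin n → ℕ → S × A)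
    (hlaw : HasLaw (fun ω => (θ ω, τ₁ ω, τ₂ ω))
      ((Measure.pi fun _ : Fin D => featureLaw (p + q) σ).prod
        ((Measure.pi fun _ : Fin n => M.trajectoryLaw π₁).prod
          (Measure.pi fun _ : Fin n => M.trajectoryLaw π₂))) μ) :
    μ.real {ω | 11 / 4 * ε ≤
        |‖embedding M.discount (θ ω) (τ₁ ω) - embedding M.discount (θ ω) (τ₂ ω)‖
          - gaussianMMD σ ((M.occupancy π₁).map concat) ((M.occupancy π₂).map concat)|}
      ≤ tailBound 1 8 n D (p + q) ε := by
  rcases le_total (n * ε ^ 2) 128 with hnε | hnε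
  · exact measureReal_le_one.trans (one_le_tailBound hnε)
  rcases le_or_gt ε 2 with hε2 | hε2
  · refine le_trans ?_ (error_sum_le_tailBound hε hε2)
    refine le_trans ?_ (sample_measure_ge_le M π₁ π₂ σ hn hD hε hnε)
    rw [← hlaw.map_eq]
    -- This direction of the comparison with the image measure needs no measurability of the event.
    exact ENNReal.toReal_mono (measure_ne_top _ _) (Measure.le_map_apply hlaw.aemeasurable _)
  · have hempty : {ω | 11 / 4 * ε ≤
        |‖embedding M.discount (θ ω) (τ₁ ω) - embedding M.discount (θ ω) (τ₂ ω)‖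
          - gaussianMMD σ ((M.occupancy π₁).map concat) ((M.occupancy π₂).map concat)|} = ∅ := by
      refine Set.eq_empty_of_forall_notMem fun ω hω => ?_
      have h := (Set.mem_ofPred_eq ▸ hω).trans
        (abs_norm_embedding_sub_sub_gaussianMMD_le M π₁ π₂ σ hn (θ ω) (τ₁ ω) (τ₂ ω))
      linarith
    rw [hempty, measureReal_empty]
    unfold tailBound
    positivity

end Main

theorem mainTheorem2 :
    ∃ c₁ : ℝ, 0 < c₁ ∧ ∃ C : ℝ, 0 < C ∧
      ∀ (p q : ℕ) (S : Set (EuclideanSpace ℝ (Fin p))) (A : Set (EuclideanSpace ℝ (Fin q)))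
        (M : MDP S A) (π₁ π₂ : Kernel S A) [IsMarkovKernel π₁] [IsMarkovKernel π₂]
        (σ : ℝ) (n D : ℕ) (ε : ℝ), 0 < σ → 1 ≤ n → 1 ≤ D → 0 < ε →
      ∀ {Ω : Type*} [MeasurableSpace Ω] (μ : Measure Ω) [IsProbabilityMeasure μ]
        (θ : Ω → Fin D → EuclideanSpace ℝ (Fin (p + q)) × ℝ)
        (τ₁ τ₂ : Ω → Fin n → ℕ → S × A),
        -- the feature parameters and the `n + n` trajectories are independent, with these laws
        HasLaw (fun ω => (θ ω, τ₁ ω, τ₂ ω))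
          ((Measure.pi fun _ : Fin D => featureLaw (p + q) σ).prod
            ((Measure.pi fun _ : Fin n => M.trajectoryLaw π₁).prod
              (Measure.pi fun _ : Fin n => M.trajectoryLaw π₂))) μ →
        -- infinite horizon
        μ.real {ω | 11 / 4 * ε ≤
            |‖embedding M.discount (θ ω) (τ₁ ω) - embedding M.discount (θ ω) (τ₂ ω)‖
              - gaussianMMD σ ((M.occupancy π₁).map concat) ((M.occupancy π₂).map concat)|}
          ≤ tailBound c₁ C n D (p + q) ε ∧
        -- finite horizon
        ∀ T : ℕ,
          μ.real {ω | 11 / 4 * ε + 2 * Real.sqrt 2 * M.discount ^ T ≤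
              |‖truncEmbedding M.discount T (θ ω) (τ₁ ω)
                  - truncEmbedding M.discount T (θ ω) (τ₂ ω)‖
                - gaussianMMD σ ((M.occupancy π₁).map concat) ((M.occupancy π₂).map concat)|}
            ≤ tailBound c₁ C n D (p + q) ε ∧
          -- the truncation bias, for every realization of the feature parameters
          ∀ θ₀ : Fin D → EuclideanSpace ℝ (Fin (p + q)) × ℝ,
            ‖(∫ τ, trajFeature M.discount θ₀ τ ∂(M.trajectoryLaw π₁))
                - ∫ τ, truncTrajFeature M.discount T θ₀ τ ∂(M.trajectoryLaw π₁)‖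
              + ‖(∫ τ, trajFeature M.discount θ₀ τ ∂(M.trajectoryLaw π₂))
                - ∫ τ, truncTrajFeature M.discount T θ₀ τ ∂(M.trajectoryLaw π₂)‖
              ≤ 2 * Real.sqrt 2 * M.discount ^ T := by
  refine ⟨1, one_pos, 8, by norm_num, ?_⟩
  intro p q S A M π₁ π₂ _ _ σ n D ε _ hn hD hε Ω _ μ _ θ τ₁ τ₂ hlaw
  have hγ0 := M.discount_pos.le
  have hγ1 := M.discount_lt_one
  have hinf := infinite_horizon_tail_le M π₁ π₂ σ hn hD hε μ θ τ₁ τ₂ hlaw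
  refine ⟨hinf, fun T => ⟨(measureReal_mono fun ω hω => ?_).trans hinf, fun θ₀ => ?_⟩⟩
  -- Two truncation errors of `√2 γ^T` each place the finite-horizon event inside the
  -- infinite-horizon one.
  · rw [Set.mem_ofPred_eq] at hω ⊢
    set x₁ := embedding M.discount (θ ω) (τ₁ ω)
    set x₂ := embedding M.discount (θ ω) (τ₂ ω)
    set y₁ := truncEmbedding M.discount T (θ ω) (τ₁ ω)
    set y₂ := truncEmbedding M.discount T (θ ω) (τ₂ ω)
    set b := gaussianMMD σ ((M.occupancy π₁).map concat) ((M.occupancy π₂).map concat)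
    have h1 : ‖x₁ - y₁‖ ≤ _ := norm_embedding_sub_truncEmbedding_le hγ0 hγ1 hn T (θ ω) (τ₁ ω)
    have h2 : ‖x₂ - y₂‖ ≤ _ := norm_embedding_sub_truncEmbedding_le hγ0 hγ1 hn T (θ ω) (τ₂ ω)
    have h3 := abs_norm_sub_norm_le (y₁ - y₂) (x₁ - x₂)
    rw [sub_sub_sub_comm] at h3
    have h4 := norm_sub_le (y₁ - x₁) (y₂ - x₂)
    rw [norm_sub_rev y₁, norm_sub_rev y₂] at h4
    have h5 := abs_sub_le ‖y₁ - y₂‖ ‖x₁ - x₂‖ b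
    linarith
  · have h1 := norm_integral_trajFeature_sub_le hγ0 hγ1 (M.trajectoryLaw π₁) T θ₀
    have h2 := norm_integral_trajFeature_sub_le hγ0 hγ1 (M.trajectoryLaw π₂) T θ₀
    linarith
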